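/- **Setting.** Let $Q=(Q_0,Q_1)$ be a finite acyclic quiver; an arrow $a$ has tail $ta$ and head $ha$. For a set of arrows $A\subseteq Q_1$ and $\gamma_1,\gamma_2\in\mathbb N^{Q_0}$ put $$\chi_A(\gamma_1,\gamma_2)=\sum_{i\in Q_0}\gamma_1(i)\gamma_2(i)-\sum_{a\in A}\gamma_1(ta)\gamma_2(ha),\qquad \lambda_A(\gamma_1,\gamma_2)=\chi_A(\gamma_2,\gamma_1)-\chi_A(\gamma_1,\gamma_2),$$ and $\lambda=\lambda_{Q_1}$. A Dynkin subquiver partition $Q^\bullet=\{Q^1,\dots,Q^\ell\}$ of $Q$ consists of pairwise disjoint, nonempty, connected subquivers $Q^j=(Q^j_0,Q^j_1)$ (not necessarily full), each an orientation of a Dynkin diagram of type $A$, $D$ or $E$, with $Q_0=\bigcup_jQ^j_0$. Let $\Phi^j\subset\mathbb N^{Q_0}$ be the set of positive roots of $Q^j$, where the simple root at a vertex $i$ is the $i$-th unit vector $e_i$ and vectors are extended by $0$ outside $Q^j_0$, and let $\Phi(Q,Q^\bullet)=\bigcup_j\Phi^j$. Let $P(Q,Q^\bullet)$ be the quiver with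 vertices $Q^1,\dots,Q^\ell$ obtained from $Q$ by contracting each $Q^j$ to a vertex; its arrows are those of $Q_1\setminus\bigcup_jQ^j_1$. Call $Q^\bullet$ *admissible* if $P(Q,Q^\bullet)$ is acyclic (in particular has no loops), and *ordered* if every arrow of $P(Q,Q^\bullet)$ with head $Q^j$ and tail $Q^{j'}$ satisfies $j<j'$. A total ordering $\phi_1\prec\cdots\prec\phi_r$ of $\Phi(Q,Q^\bullet)$ is said to satisfy the *ordering rules* if for all $u<v$, with $\phi_u\in\Phi^j$ and $\phi_v\in\Phi^{j'}$: * if $j=j'$, then $\lambda_{Q^j_1}(\phi_u,\phi_v)\ge 0$ and $\lambda_{Q_1\setminus Q^j_1}(\phi_u,\phi_v)\le 0$; * if $j\ne j'$, then $\lambda(\phi_u,\phi_v)\le 0$. It satisfies the *simplified rules* if for all such $u<v$: $\lambda(\phi_u,\phi_v)\ge0$ when $j=j'$, and $\lambda(\phi_u,\phi_v)\le0$ when $j\neq j'$. **Theorem.** 1. A total ordering of $\Phi(Q,Q^\bullet)$ satisfying the ordering rules exists if and only if $Q^\bullet$ is admissible. 2. If $Q^\bullet$ is admissible, then a total ordering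 of $\Phi(Q,Q^\bullet)$ satisfies the ordering rules if and only if it satisfies the simplified rules. 3. If $Q^\bullet$ is ordered, then each $\Phi^j$ has a total ordering $\beta^j_1\prec\cdots\prec\beta^j_{r_j}$ with $\lambda(\beta^j_u,\beta^j_v)\ge0$ for $u<v$; and for every choice of such orderings of $\Phi^1,\dots,\Phi^\ell$, the concatenated ordering $\Phi^1\prec\cdots\prec\Phi^\ell$ of $\Phi(Q,Q^\bullet)$ satisfies the ordering rules and the simplified rules. 4. Such a total ordering is in general not unique: there are a finite acyclic quiver and an admissible Dynkin subquiver partition of it for which two different total orderings satisfy the ordering rules. -/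

import Mathlib

universe u v

noncomputable section

namespace QuiverRoots

/-- A quiver is acyclic if it has no oriented cycles (in particular no loops):
every path from a vertex to itself is trivial. -/
def IsAcyclic (V : Type u) [Quiver.{v} V] : Prop :=
  ∀ (i : V) (p : Quiver.Path i i), p.length = 0

/-- The Euler form attached to a set `A` of arrows of a quiver with vertex set `V`:
`χ_A(γ₁, γ₂) = ∑ᵢ γ₁(i) γ₂(i) - ∑_{a ∈ A} γ₁(ta) γ₂(ha)`. The sum over `a ∈ A` is grouped by the
tail `i` and the head `j` of `a`. For `A = ⊤` this is the usual Euler form of the quiver. -/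
def eulerForm {V : Type u} [Fintype V] [Quiver.{v} V] (A : WideSubquiver V) (γ₁ γ₂ : V → ℕ) : ℤ :=
  ∑ i, (γ₁ i : ℤ) * (γ₂ i : ℤ) - ∑ i, ∑ j, ((A i j).ncard : ℤ) * ((γ₁ i : ℤ) * (γ₂ j : ℤ))

/-- The opposite antisymmetrization `λ_A(γ₁, γ₂) = χ_A(γ₂, γ₁) - χ_A(γ₁, γ₂)`. On simple roots,
`λ_A(eᵢ, eⱼ)` is the number of arrows `i ⟶ j` in `A` minus the number of arrows `j ⟶ i` in `A`. -/
def lam {V : Type u} [Fintype V] [Quiver.{v} V] (A : WideSubquiver V) (γ₁ γ₂ : V → ℕ) : ℤ :=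
  eulerForm A γ₂ γ₁ - eulerForm A γ₁ γ₂

/-- The complementary set of arrows. -/
def arrowCompl {V : Type u} [Quiver.{v} V] (A : WideSubquiver V) : WideSubquiver V :=
  fun i j => (A i j)ᶜ

/-- A subquiver: a set of vertices together with a set of arrows between these vertices.
It need not be full. -/
structure Subquiver (V : Type u) [Quiver.{v} V] where
  verts : Set V
  arrows : WideSubquiver V
  tail_mem : ∀ {i j : V} {a : i ⟶ j}, a ∈ arrows i j → i ∈ verts
  head_mem : ∀ {i j : V} {a : i ⟶ j}, a ∈ arrows i j → j ∈ verts

namespace Subquiver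

variable {V : Type u} [Quiver.{v} V]

/-- The generalized Cartan matrix of the undirected graph underlying a subquiver: off the diagonal
it is minus the number of edges between the two vertices. -/
def cartan [DecidableEq V] (S : Subquiver V) (i j : V) : ℤ :=
  (if i = j then 2 else 0) - ((S.arrows i j).ncard : ℤ) - ((S.arrows j i).ncard : ℤ)

/-- The Cartan matrix of the subquiver is `M`, up to a numbering of its vertices; that is, the
underlying graph of the subquiver is the (simply-laced) Dynkin diagram of `M`. -/
def HasType [DecidableEq V] (S : Subquiver V) {n : ℕ} (M : Matrix (Fin n) (Fin n) ℤ) : Prop :=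
  ∃ e : Fin n ≃ S.verts, ∀ a b, S.cartan (e a) (e b) = M a b

/-- A (nonempty, connected) Dynkin quiver: an orientation of a Dynkin diagram of type
`A_n` (`n ≥ 1`), `D_n` (`n ≥ 4`), `E₆`, `E₇` or `E₈`. These diagrams are all nonempty and connected,
so this is part of the definition. -/
def IsDynkin [DecidableEq V] (S : Subquiver V) : Prop :=
  (∃ n, 1 ≤ n ∧ S.HasType (CartanMatrix.A n)) ∨
  (∃ n, 4 ≤ n ∧ S.HasType (CartanMatrix.D n)) ∨
  S.HasType CartanMatrix.E₆ ∨ S.HasType CartanMatrix.E₇ ∨ S.HasType CartanMatrix.E₈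

/-- The roots of a Dynkin subquiver, in coordinates with respect to the simple roots `αᵢ = eᵢ`
(`i` a vertex of the subquiver): the smallest set that contains the simple roots and is stable
under the simple reflections `sᵢ(β) = β - ⟨β, αᵢ^∨⟩ αᵢ`. -/
inductive IsRoot [Fintype V] [DecidableEq V] (S : Subquiver V) : (V → ℤ) → Prop
  | simple (i : V) (hi : i ∈ S.verts) : IsRoot S (Pi.single i 1)
  | reflect (i : V) (hi : i ∈ S.verts) (β : V → ℤ) (hβ : IsRoot S β) :
      IsRoot S (β - Pi.single i (∑ j, S.cartan i j * β j))

/-- The set of positive roots of a Dynkin subquiver, as a set of dimension vectors of the ambient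
quiver (extended by zero outside the subquiver). -/
def posRoots [Fintype V] [DecidableEq V] (S : Subquiver V) : Set (V → ℕ) :=
  {β | S.IsRoot (fun i => (β i : ℤ))}

end Subquiver

/-- A Dynkin subquiver partition of a quiver with vertex set `V` into `ℓ` labelled parts: pairwise
disjoint (nonempty, connected) Dynkin subquivers that together contain all vertices. -/
structure DynkinPartition (V : Type u) [DecidableEq V] [Quiver.{v} V] (ℓ : ℕ) where
  part : Fin ℓ → Subquiver V
  isDynkin : ∀ j, (part j).IsDynkin
  disjoint : ∀ j j', j ≠ j' → Disjoint (part j).verts (part j').verts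
  cover : ∀ i : V, ∃ j, i ∈ (part j).verts

namespace DynkinPartition

variable {V : Type u} [DecidableEq V] [Quiver.{v} V] {ℓ : ℕ}

/-- The vertex set of the quiver obtained by contracting every part to a single vertex. -/
def Contraction (_P : DynkinPartition V ℓ) : Type := Fin ℓ

/-- The contracted quiver: its arrows `j ⟶ j'` are the arrows of the ambient quiver that lie in none
of the parts and have their tail in part `j` and their head in part `j'`. -/
instance (P : DynkinPartition V ℓ) : Quiver.{max u v} P.Contraction where
  Hom j j' := {a : Quiver.Total V //
    a.left ∈ (P.part j).verts ∧ a.right ∈ (P.part j').verts ∧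
      ∀ k, a.hom ∉ (P.part k).arrows a.left a.right}

/-- The partition is admissible if its contracted quiver is acyclic. -/
def IsAdmissible (P : DynkinPartition V ℓ) : Prop :=
  IsAcyclic P.Contraction

/-- The partition is ordered if, for every arrow of the contracted quiver, the label of its head is
smaller than the label of its tail. -/
def IsOrdered (P : DynkinPartition V ℓ) : Prop :=
  ∀ t h : Fin ℓ,
    Nonempty (Quiver.Hom (V := P.Contraction) t h) → h < t

variable [Fintype V]

/-- The union of the sets of positive roots of the parts. -/
def roots (P : DynkinPartition V ℓ) : Set (V → ℕ) :=
  ⋃ j, (P.part j).posRoots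

/-- The ordering rules, for a total ordering `φ 0 ≺ φ 1 ≺ ⋯ ≺ φ (r - 1)` of all the roots: two roots
`φ u ≺ φ v` of the same part `Q^j` satisfy `λ ≥ 0` for the arrows in `Q^j` and `λ ≤ 0` for the arrows
not in `Q^j`, and two roots `φ u ≺ φ v` of different parts satisfy `λ ≤ 0`. -/
def OrderRules (P : DynkinPartition V ℓ) {r : ℕ} (φ : Fin r ≃ P.roots) : Prop :=
  ∀ u v : Fin r, u < v → ∀ j j' : Fin ℓ,
    (φ u : V → ℕ) ∈ (P.part j).posRoots → (φ v : V → ℕ) ∈ (P.part j').posRoots →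
      (j = j' → 0 ≤ lam (P.part j).arrows (φ u) (φ v) ∧
        lam (arrowCompl (P.part j).arrows) (φ u) (φ v) ≤ 0) ∧
      (j ≠ j' → lam ⊤ (φ u : V → ℕ) (φ v : V → ℕ) ≤ 0)

/-- The simplified ordering rules: `λ ≥ 0` for `φ u ≺ φ v` in the same part, and
`λ ≤ 0` for `φ u ≺ φ v` in different parts. -/
def SimpleOrderRules (P : DynkinPartition V ℓ) {r : ℕ} (φ : Fin r ≃ P.roots) : Prop :=
  ∀ u v : Fin r, u < v → ∀ j j' : Fin ℓ,
    (φ u : V → ℕ) ∈ (P.part j).posRoots → (φ v : V → ℕ) ∈ (P.part j').posRoots →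
      (j = j' → 0 ≤ lam ⊤ (φ u : V → ℕ) (φ v : V → ℕ)) ∧
      (j ≠ j' → lam ⊤ (φ u : V → ℕ) (φ v : V → ℕ) ≤ 0)

/-- The first simplified rule, for a total ordering of the positive roots of the part `j` only. -/
def PartOrderRule (P : DynkinPartition V ℓ) (j : Fin ℓ) {s : ℕ}
    (β : Fin s ≃ (P.part j).posRoots) : Prop :=
  ∀ u v : Fin s, u < v → 0 ≤ lam ⊤ (β u : V → ℕ) (β v : V → ℕ)

/-- The total ordering `φ` of all the roots is the concatenation
`β 0 0 ≺ ⋯ ≺ β 0 (s 0 - 1) ≺ β 1 0 ≺ ⋯` of the given orderings `β j` of the parts. -/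
def IsConcat (P : DynkinPartition V ℓ) {s : Fin ℓ → ℕ}
    (β : ∀ j, Fin (s j) ≃ (P.part j).posRoots) (φ : Fin (∑ j, s j) ≃ P.roots) : Prop :=
  ∀ (j : Fin ℓ) (k : Fin (s j)), (φ (finSigmaFinEquiv ⟨j, k⟩) : V → ℕ) = β j k

end DynkinPartition

end QuiverRoots

end

/-!
An ordering of the positive roots of one Dynkin subquiver comes from sink reflections. Number the
vertices so that arrows decrease the number, and reflect periodically at the vertices, starting with
the smallest; each reflection turns a sink of the current orientation into a source and is an
isometry for the antisymmetrized Euler forms of the two orientations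
(`IsPosCartan.orient_reflection`). Every positive root becomes, after finitely many steps, the
simple root at the vertex about to be reflected: otherwise its orbit would stay positive, and a sum over a
period of the orbit would be a nonzero vector fixed by a Coxeter element
(`IsPosCartan.exists_reflSeq_eq_single`). At that moment the sign of the form against all roots that
are still positive can be read off, so the roots are ordered by the number of steps
(`IsPosCartan.exists_root_order`). The argument needs only that the Cartan matrix is positive
definite, which follows for all types from a positive vector with nonnegative and nonzero image
(`form_pos_of_weight`, `Subquiver.IsDynkin.isPosCartan`).

For an admissible partition every part is a full subquiver, so both sets of rules agree. A height on
the contracted quiver that decreases along its arrows orders the parts; within the parts, one uses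
the orderings above. Roots of different parts are then compared correctly because all arrows between
two parts point the same way (`DynkinPartition.exists_orderRules_of_height`).

Conversely, suppose that an ordering satisfies the rules. Loops and cycles of length two in the
contracted quiver are excluded with the roots that are indicator vectors of geodesics. Choose the
ends of the offending arrows at minimal distance. Then, for every way to cut the geodesic between
them in two, the rules for arrows outside the parts force the initial segment to precede the final
segment, and the rule for arrows of the part then forces the edge that is cut to point forwards
(`DynkinPartition.IsRank.nonempty_path`). Thus the geodesics are oriented paths, and together with
the offending arrows they form an oriented cycle of the ambient quiver. Once all arrows between two
parts point the same way, the positions of roots with full support decrease along the arrows of the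
contracted quiver, which is therefore acyclic (`DynkinPartition.IsRank.isAdmissible`).
-/

namespace QuiverRoots

/-! ### Simply-laced positive definite Cartan matrices -/

section PositiveDefinite

variable {V : Type u} [Fintype V] [DecidableEq V]

/-- A symmetric generalized Cartan matrix whose quadratic form is positive definite on integer
vectors. -/
structure IsPosCartan (C : Matrix V V ℤ) : Prop where
  symm : ∀ i j, C i j = C j i
  diag : ∀ i, C i i = 2
  off_diag : ∀ i j, i ≠ j → C i j ≤ 0
  pos : ∀ x : V → ℤ, x ≠ 0 → 0 < Matrix.toBilin' C x x

theorem toBilin'_single_left (M : Matrix V V ℤ) (i : V) (y : V → ℤ) :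
    Matrix.toBilin' M (Pi.single i 1) y = ∑ j, M i j * y j := by
  rw [Matrix.toBilin'_apply, Finset.sum_eq_single i]
  · simp
  · intro b _ hb
    simp [Pi.single_eq_of_ne hb]
  · simp

theorem toBilin'_transpose (M : Matrix V V ℤ) (x y : V → ℤ) :
    Matrix.toBilin' M.transpose x y = Matrix.toBilin' M y x := by
  rw [Matrix.toBilin'_apply, Matrix.toBilin'_apply, Finset.sum_comm]
  refine Finset.sum_congr rfl fun i _ => Finset.sum_congr rfl fun j _ => ?_
  rw [Matrix.transpose_apply]; ring

/-- The simple reflection `x ↦ x - ⟨x, αᵢ^∨⟩ αᵢ` of a Cartan matrix. -/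
def reflection (C : Matrix V V ℤ) (i : V) : (V → ℤ) →ₗ[ℤ] (V → ℤ) :=
  LinearMap.id - (Matrix.toBilin' C (Pi.single i 1)).smulRight (Pi.single i 1)

theorem reflection_apply (C : Matrix V V ℤ) (i : V) (x : V → ℤ) :
    reflection C i x = x - Matrix.toBilin' C (Pi.single i 1) x • Pi.single i 1 := rfl

theorem reflection_eq_sub_single (C : Matrix V V ℤ) (i : V) (x : V → ℤ) :
    reflection C i x = x - Pi.single i (∑ j, C i j * x j) := by
  rw [reflection_apply, toBilin'_single_left, ← Pi.single_smul]
  simp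

theorem reflection_apply_of_ne (C : Matrix V V ℤ) {i k : V} (h : k ≠ i) (x : V → ℤ) :
    reflection C i x k = x k := by
  simp [reflection_apply, Pi.single_eq_of_ne h]

theorem reflection_apply_self (C : Matrix V V ℤ) (i : V) (x : V → ℤ) :
    reflection C i x i = x i - Matrix.toBilin' C (Pi.single i 1) x := by
  simp [reflection_apply]

namespace IsPosCartan

variable {C : Matrix V V ℤ} (hC : IsPosCartan C)
include hC

theorem form_comm (x y : V → ℤ) : Matrix.toBilin' C x y = Matrix.toBilin' C y x := by
  have : C.transpose = C := by
    ext i j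
    exact hC.symm _ _
  rw [← toBilin'_transpose, this]

theorem form_single_single (i : V) :
    Matrix.toBilin' C (Pi.single i 1) (Pi.single i 1) = 2 := by
  rw [Matrix.toBilin'_single, hC.diag]

theorem form_self_nonneg (x : V → ℤ) : 0 ≤ Matrix.toBilin' C x x := by
  by_cases h : x = 0
  · simp [h]
  · exact (hC.pos x h).le

theorem eq_zero_of_form_self_nonpos {x : V → ℤ} (h : Matrix.toBilin' C x x ≤ 0) : x = 0 := by
  by_contra h0
  exact absurd (hC.pos x h0) (not_lt.mpr h)

theorem form_add_self (x y : V → ℤ) : Matrix.toBilin' C (x + y) (x + y) =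
    Matrix.toBilin' C x x + 2 * Matrix.toBilin' C x y + Matrix.toBilin' C y y := by
  simp only [map_add, LinearMap.add_apply]
  rw [hC.form_comm y x]; ring

theorem form_sub_self (x y : V → ℤ) : Matrix.toBilin' C (x - y) (x - y) =
    Matrix.toBilin' C x x - 2 * Matrix.toBilin' C x y + Matrix.toBilin' C y y := by
  simp only [map_sub, LinearMap.sub_apply]
  rw [hC.form_comm y x]; ring

theorem even_form_self (x : V → ℤ) : Even (Matrix.toBilin' C x x) := by
  rw [← Finset.univ_sum_single x]
  induction (Finset.univ : Finset V) using Finset.induction_on with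
  | empty => simp
  | insert a s ha ih =>
    rw [Finset.sum_insert ha, hC.form_add_self]
    refine (Even.add ?_ (even_two_mul _)).add ih
    have : (Pi.single a (x a) : V → ℤ) = x a • Pi.single a 1 := by
      rw [← Pi.single_smul]; simp
    rw [this, map_smul, map_smul, LinearMap.smul_apply, hC.form_single_single]
    exact ⟨x a * x a, by simp only [smul_eq_mul]; ring⟩

theorem form_reflection (i : V) (x y : V → ℤ) :
    Matrix.toBilin' C (reflection C i x) (reflection C i y) = Matrix.toBilin' C x y := by
  simp only [reflection_apply, map_sub, LinearMap.sub_apply, map_smul, LinearMap.smul_apply,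
    smul_eq_mul, hC.form_single_single]
  rw [hC.form_comm x (Pi.single i 1)]; ring

theorem reflection_single (i : V) : reflection C i (Pi.single i 1) = -Pi.single i 1 := by
  rw [reflection_apply, hC.form_single_single, two_smul]; abel

theorem reflection_reflection (i : V) (x : V → ℤ) :
    reflection C i (reflection C i x) = x := by
  conv_lhs => rw [reflection_apply C i x]
  rw [map_sub, map_smul, hC.reflection_single, reflection_apply]
  simp

/-- A vector of norm two has coordinates of constant sign: otherwise its positive and negative
parts, whose pairing is nonpositive, would contribute at least two each to the norm. -/
theorem nonneg_or_nonpos {x : V → ℤ} (hx : Matrix.toBilin' C x x = 2) :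
    0 ≤ x ∨ x ≤ 0 := by
  have hsplit : x = x⁺ - x⁻ := (posPart_sub_negPart x).symm
  have hcross : Matrix.toBilin' C x⁺ x⁻ ≤ 0 := by
    rw [Matrix.toBilin'_apply]
    refine Finset.sum_nonpos fun i _ => Finset.sum_nonpos fun j _ => ?_
    have h1 : 0 ≤ x⁺ i := posPart_nonneg x i
    have h2 : 0 ≤ x⁻ j := negPart_nonneg x j
    by_cases hij : i = j
    · subst hij
      have : x⁺ i = 0 ∨ x⁻ i = 0 := by
        rw [Pi.posPart_apply, Pi.negPart_apply]
        rcases le_total (x i) 0 with h | h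
        · left; exact posPart_eq_zero.mpr h
        · right; exact negPart_eq_zero.mpr h
      rcases this with h | h <;> simp [h]
    · have := hC.off_diag i j hij
      have h3 : x⁺ i * C i j ≤ 0 := mul_nonpos_of_nonneg_of_nonpos h1 this
      exact mul_nonpos_of_nonpos_of_nonneg h3 h2
  have key := hC.form_sub_self x⁺ x⁻
  rw [← hsplit, hx] at key
  by_contra hcon
  push Not at hcon
  have hp : x⁺ ≠ 0 := fun h => hcon.2 (posPart_eq_zero.mp h)
  have hn : x⁻ ≠ 0 := fun h => hcon.1 (negPart_eq_zero.mp h)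
  obtain ⟨a, ha⟩ := hC.even_form_self x⁺
  obtain ⟨b, hb⟩ := hC.even_form_self x⁻
  have := hC.pos _ hp
  have := hC.pos _ hn
  omega

/-- A simple reflection permutes the positive norm-two vectors other than its simple root. -/
theorem reflection_nonneg {x : V → ℤ} (hx : Matrix.toBilin' C x x = 2) (h0 : 0 ≤ x) {i : V}
    (hi : x ≠ Pi.single i 1) : 0 ≤ reflection C i x := by
  rcases hC.nonneg_or_nonpos ((hC.form_reflection i x x).trans hx) with h | h
  · exact h
  exfalso
  have hx' : x = x i • Pi.single i 1 := by
    ext k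
    by_cases hk : k = i
    · subst hk; simp
    · have h1 := h k
      rw [reflection_apply_of_ne C hk] at h1
      simpa [Pi.single_eq_of_ne hk] using le_antisymm h1 (h0 k)
  have h2 := hx
  rw [hx', map_smul, map_smul, LinearMap.smul_apply, hC.form_single_single] at h2
  simp only [smul_eq_mul] at h2
  have h3 : x i = 1 := by
    have h4 : 0 ≤ x i := h0 i
    nlinarith
  rw [h3, one_smul] at hx'
  exact hi hx'

/-- There are finitely many vectors of norm two: for each `i`, some nonzero multiple of the
coordinate `x i` is the pairing of `x` with a fixed vector `z`, and positivity at `x + z` and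
`x - z` bounds this pairing. -/
theorem finite_norm_two : {x : V → ℤ | Matrix.toBilin' C x x = 2}.Finite := by
  have hdet : C.det ≠ 0 := by
    intro h
    obtain ⟨z, hz, h0⟩ := Matrix.exists_mulVec_eq_zero_iff.mpr h
    have := hC.pos z hz
    rw [Matrix.toBilin'_apply', h0] at this
    simp at this
  have hz : ∀ i, ∃ z : V → ℤ, ∀ x, Matrix.toBilin' C x z = C.det * x i := by
    intro i
    refine ⟨C.adjugate.mulVec (Pi.single i 1), fun x => ?_⟩
    rw [Matrix.toBilin'_apply', Matrix.mulVec_mulVec, Matrix.mul_adjugate, Matrix.smul_mulVec,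
      Matrix.one_mulVec, dotProduct_smul, dotProduct_single]
    simp
  choose z hz using hz
  refine (Set.Finite.pi' (t := fun i => Set.Icc (-(2 + Matrix.toBilin' C (z i) (z i)))
    (2 + Matrix.toBilin' C (z i) (z i))) fun i => Set.finite_Icc _ _).subset ?_
  intro x hx i
  have h1 := hC.form_self_nonneg (x + z i)
  have h2 := hC.form_self_nonneg (x - z i)
  rw [hC.form_add_self, hz, Set.mem_ofPred_eq.mp hx] at h1
  rw [hC.form_sub_self, hz, Set.mem_ofPred_eq.mp hx] at h2
  have h3 : |C.det * x i| ≤ 2 + Matrix.toBilin' C (z i) (z i) := by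
    have := hC.form_self_nonneg (z i)
    rw [abs_le]; constructor <;> linarith
  have h4 : |x i| ≤ |C.det * x i| := by
    rw [abs_mul]
    have : 1 ≤ |C.det| := Int.one_le_abs hdet
    nlinarith [abs_nonneg (x i)]
  exact abs_le.mp (h4.trans h3)

end IsPosCartan

end PositiveDefinite

/-! ### Ordering the positive roots by sink reflections -/

section Orientation

variable {V : Type u} [Fintype V] [DecidableEq V]

/-- The antisymmetric matrix of the orientation of a simply-laced diagram whose edges point from
larger to smaller values of `h`: its entry at `(i, j)` is the number of arrows `i ⟶ j` minus the
number of arrows `j ⟶ i`. -/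
def orient (C : Matrix V V ℤ) (h : V → ℕ) : Matrix V V ℤ :=
  Matrix.of fun i j => if h j < h i then -C i j else if h i < h j then C i j else 0

theorem orient_apply {V : Type u} (C : Matrix V V ℤ) (h : V → ℕ) (i j : V) :
    orient C h i j = if h j < h i then -C i j else if h i < h j then C i j else 0 := rfl

theorem IsPosCartan.orient_antisymm {C : Matrix V V ℤ} (hC : IsPosCartan C) (h : V → ℕ)
    (x y : V → ℤ) :
    Matrix.toBilin' (orient C h) x y = -Matrix.toBilin' (orient C h) y x := by
  have : (orient C h).transpose = -orient C h := by
    ext i j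
    rw [Matrix.transpose_apply, Matrix.neg_apply, orient_apply, orient_apply, hC.symm j i]
    split_ifs <;> omega
  rw [← toBilin'_transpose, this, map_neg, LinearMap.neg_apply, LinearMap.neg_apply]

/-- Pairing with the simple root at a sink of the whole orientation. -/
theorem IsPosCartan.orient_single_of_min {C : Matrix V V ℤ} (hC : IsPosCartan C) {h : V → ℕ}
    {i : V} (hi : ∀ j, j ≠ i → h i < h j) (y : V → ℤ) :
    Matrix.toBilin' (orient C h) (Pi.single i 1) y =
      Matrix.toBilin' C (Pi.single i 1) y - 2 * y i := by
  rw [toBilin'_single_left, toBilin'_single_left, Fintype.sum_eq_add_sum_compl i,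
    Fintype.sum_eq_add_sum_compl i (fun j => C i j * y j), hC.diag, orient_apply]
  have : ∑ j ∈ {i}ᶜ, orient C h i j * y j = ∑ j ∈ {i}ᶜ, C i j * y j := by
    refine Finset.sum_congr rfl fun j hj => ?_
    have hj' := hi j (by simpa using hj)
    rw [orient_apply, if_neg (by omega), if_pos hj']
  rw [this]
  simp

/-- Turning the minimum `i` of the height into its maximum negates the row and the column of `i`. -/
theorem toBilin'_orient_raise {C : Matrix V V ℤ} {h h' : V → ℕ} {i : V}
    (hi : ∀ j, j ≠ i → h i < h j) (hne : ∀ j, j ≠ i → h' j = h j) (hi' : ∀ j, j ≠ i → h' j < h' i)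
    (x y : V → ℤ) :
    Matrix.toBilin' (orient C h') x y = Matrix.toBilin' (orient C h) x y
      - 2 * x i * Matrix.toBilin' (orient C h) (Pi.single i 1) y
      - 2 * y i * Matrix.toBilin' (orient C h) x (Pi.single i 1) := by
  rw [← toBilin'_transpose _ (Pi.single i 1) x, toBilin'_single_left, toBilin'_single_left,
    Matrix.toBilin'_apply, Matrix.toBilin'_apply]
  have key : ∀ p q, x p * orient C h' p q * y q = x p * orient C h p q * y q
      - (if p = i then 2 * x i * (orient C h i q * y q) else 0)
      - (if q = i then 2 * y i * ((orient C h).transpose i p * x p) else 0) := by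
    intro p q
    simp only [Matrix.transpose_apply, orient_apply]
    by_cases hp : p = i <;> by_cases hq : q = i
    · subst hp; subst hq; simp
    · subst hp
      have h1 := hi q hq
      have h2 := hi' q hq
      rw [if_pos h2, if_neg (by omega), if_pos h1, if_pos rfl, if_neg hq]
      ring
    · subst hq
      have h1 := hi p hp
      have h2 := hi' p hp
      rw [if_neg (by omega), if_pos h2, if_pos h1, if_neg hp, if_pos rfl]
      ring
    · rw [hne p hp, hne q hq, if_neg hp, if_neg hq]
      ring
  simp only [key, Finset.sum_sub_distrib]
  congr 1
  · congr 1
    rw [Finset.sum_comm]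
    simp [Finset.mul_sum]
  · simp [Finset.mul_sum]

/-- The reflection at a sink is an isometry between the antisymmetrized Euler forms of an
orientation and of the orientation in which the sink has become a source. -/
theorem IsPosCartan.orient_reflection {C : Matrix V V ℤ} (hC : IsPosCartan C) {h h' : V → ℕ}
    {i : V} (hi : ∀ j, j ≠ i → h i < h j) (hne : ∀ j, j ≠ i → h' j = h j)
    (hi' : ∀ j, j ≠ i → h' j < h' i) (x y : V → ℤ) :
    Matrix.toBilin' (orient C h') (reflection C i x) (reflection C i y) =
      Matrix.toBilin' (orient C h) x y := by
  rw [toBilin'_orient_raise hi hne hi']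
  have h1 := hC.orient_single_of_min hi y
  have h2 := hC.orient_single_of_min hi x
  have h3 := hC.orient_antisymm h x (Pi.single i 1)
  have h4 : Matrix.toBilin' (orient C h) (Pi.single i 1) (Pi.single i 1) = 0 := by
    have := hC.orient_antisymm h (Pi.single i 1) (Pi.single i 1)
    omega
  rw [h2] at h3
  rw [reflection_apply_self, reflection_apply_self]
  simp only [reflection_apply, map_sub, LinearMap.sub_apply, map_smul, LinearMap.smul_apply,
    smul_eq_mul, h4, h1, h3]
  ring

/-- The composite of the reflections at `i 0, …, i (t - 1)`, the one at `i 0` being applied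
first. -/
def reflSeq (C : Matrix V V ℤ) (i : ℕ → V) : ℕ → (V → ℤ) →ₗ[ℤ] (V → ℤ)
  | 0 => LinearMap.id
  | t + 1 => reflection C (i t) ∘ₗ reflSeq C i t

theorem reflSeq_succ (C : Matrix V V ℤ) (i : ℕ → V) (t : ℕ) (x : V → ℤ) :
    reflSeq C i (t + 1) x = reflection C (i t) (reflSeq C i t x) := rfl

namespace IsPosCartan

variable {C : Matrix V V ℤ} (hC : IsPosCartan C)
include hC

theorem form_reflSeq (i : ℕ → V) (t : ℕ) (x y : V → ℤ) :
    Matrix.toBilin' C (reflSeq C i t x) (reflSeq C i t y) = Matrix.toBilin' C x y := by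
  induction t with
  | zero => rfl
  | succ t ih => rw [reflSeq_succ, reflSeq_succ, hC.form_reflection, ih]

theorem reflSeq_injective (i : ℕ → V) (t : ℕ) : Function.Injective (reflSeq C i t) := by
  induction t with
  | zero => exact fun _ _ h => h
  | succ t ih =>
    exact (Function.LeftInverse.injective (hC.reflection_reflection (i t))).comp ih

theorem reflSeq_nonneg (i : ℕ → V) {x : V → ℤ} (hx : Matrix.toBilin' C x x = 2) (h0 : 0 ≤ x)
    {t : ℕ} (ht : ∀ s < t, reflSeq C i s x ≠ Pi.single (i s) 1) : 0 ≤ reflSeq C i t x := by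
  induction t with
  | zero => exact h0
  | succ t ih =>
    rw [reflSeq_succ]
    exact hC.reflection_nonneg ((hC.form_reflSeq i t x x).trans hx)
      (ih fun s hs => ht s (by omega)) (ht t (by omega))

/-- A vector fixed by a product of the reflections at all the vertices, each used once, vanishes:
the reflection at `v` is the only one that changes the coordinate `v`. The hypotheses describe the
intermediate images of the vector. -/
theorem eq_zero_of_fixed {n : ℕ} (σ : Fin n ≃ V) (Y : ℕ → V → ℤ)
    (hY : ∀ s : Fin n, Y (s + 1) = reflection C (σ s) (Y s)) (hfix : Y n = Y 0) : Y 0 = 0 := by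
  have hstep : ∀ s : Fin n, ∀ t : ℕ, t ≤ s → Y t (σ s) = Y 0 (σ s) := by
    intro s t
    induction t with
    | zero => intro _; rfl
    | succ t ih =>
      intro hts
      rw [hY ⟨t, by omega⟩, reflection_apply_of_ne, ih (by omega)]
      intro h
      have := congrArg Fin.val (σ.injective h)
      simp at this
      omega
  have hstep' : ∀ s : Fin n, ∀ t, s + 1 + t ≤ n → Y (s + 1 + t) (σ s) = Y (s + 1) (σ s) := by
    intro s t
    induction t with
    | zero => intro _; rfl
    | succ t ih =>
      intro hts
      have := hY ⟨s + 1 + t, by omega⟩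
      simp only at this
      rw [← add_assoc, this, reflection_apply_of_ne, ih (by omega)]
      intro h
      have := congrArg Fin.val (σ.injective h)
      simp at this
      omega
  have hpair : ∀ s : Fin n, Matrix.toBilin' C (Pi.single (σ s) 1) (Y s) = 0 := by
    intro s
    have h1 := hstep s s le_rfl
    have h2 := hstep' s (n - (s + 1)) (by omega)
    rw [show (s : ℕ) + 1 + (n - (s + 1)) = n by omega, hfix, hY s, reflection_apply_self] at h2
    omega
  have hconst : ∀ t ≤ n, Y t = Y 0 := by
    intro t
    induction t with
    | zero => intro _; rfl
    | succ t ih =>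
      intro ht
      have h1 := hY ⟨t, ht⟩
      have h2 := hpair ⟨t, ht⟩
      simp only at h1 h2
      rw [h1, reflection_apply, h2, zero_smul, sub_zero, ih (by omega)]
  refine hC.eq_zero_of_form_self_nonpos (le_of_eq ?_)
  rw [Matrix.toBilin'_apply]
  refine Finset.sum_eq_zero fun v _ => ?_
  have h1 := hpair (σ.symm v)
  rw [hconst _ (σ.symm v).2.le, toBilin'_single_left, Equiv.apply_symm_apply] at h1
  simp only [mul_assoc, ← Finset.mul_sum, h1, mul_zero]

/-- Reflecting periodically at all the vertices, every positive norm-two vector eventually becomes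
the simple root about to be reflected. Otherwise it would stay positive forever and, by finiteness,
return to a previous value after a number of periods; the sum of its values over the periods in
between would be a nonzero vector fixed by the product of the reflections in one period. -/
theorem exists_reflSeq_eq_single {n : ℕ} (σ : Fin n ≃ V) (i : ℕ → V)
    (hi : ∀ (k : ℕ) (s : Fin n), i (k * n + s) = σ s) {x : V → ℤ}
    (hx : Matrix.toBilin' C x x = 2) (h0 : 0 ≤ x) :
    ∃ t, reflSeq C i t x = Pi.single (i t) 1 := by
  by_contra hcon
  push Not at hcon
  have hnn : ∀ t, 0 ≤ reflSeq C i t x := fun t => hC.reflSeq_nonneg i hx h0 fun s _ => hcon s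
  have hnorm : ∀ t, Matrix.toBilin' C (reflSeq C i t x) (reflSeq C i t x) = 2 :=
    fun t => (hC.form_reflSeq i t x x).trans hx
  obtain ⟨a, b, hab, heq⟩ : ∃ a b, a < b ∧ reflSeq C i (a * n) x = reflSeq C i (b * n) x := by
    have := hC.finite_norm_two.to_subtype
    obtain ⟨a, b, hne, h⟩ := Finite.exists_ne_map_eq_of_infinite
      (fun k : ℕ => (⟨reflSeq C i (k * n) x, hnorm _⟩ : {x : V → ℤ | Matrix.toBilin' C x x = 2}))
    have h' := congrArg Subtype.val h
    rcases lt_or_gt_of_ne hne with hlt | hlt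
    · exact ⟨a, b, hlt, h'⟩
    · exact ⟨b, a, hlt, h'.symm⟩
  let Y : ℕ → V → ℤ := fun t => ∑ k ∈ Finset.range (b - a), reflSeq C i ((a + k) * n + t) x
  have hY0 : Y 0 = 0 := by
    refine hC.eq_zero_of_fixed σ Y (fun s => ?_) ?_
    · simp only [Y, map_sum]
      refine Finset.sum_congr rfl fun k _ => ?_
      rw [← add_assoc, reflSeq_succ, hi]
    · have := Finset.sum_range_sub (fun k => reflSeq C i ((a + k) * n) x) (b - a)
      rw [Nat.add_sub_cancel' hab.le, add_zero, heq, sub_self, Finset.sum_sub_distrib,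
        sub_eq_zero] at this
      simp only [Y, add_zero]
      rw [← this]
      refine Finset.sum_congr rfl fun k _ => ?_
      rw [← add_assoc, add_mul (a + k) 1, one_mul]
  have h1 := (Finset.sum_eq_zero_iff_of_nonneg fun k _ => hnn _).mp hY0 0
    (Finset.mem_range.mpr (by omega))
  have h2 := hnorm ((a + 0) * n + 0)
  rw [h1] at h2
  simp at h2

end IsPosCartan

/-- The heights of the orientations obtained from the one of height `σ.symm` by reflecting at
`i 0, i 1, …`: every reflection raises the height of the current sink by `n`. -/
def heightSeq {n : ℕ} (σ : Fin n ≃ V) (i : ℕ → V) : ℕ → V → ℕ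
  | 0 => fun v => σ.symm v
  | t + 1 => fun v => if v = i t then heightSeq σ i t v + n else heightSeq σ i t v

theorem heightSeq_bounds {V : Type u} [DecidableEq V] {n : ℕ} (σ : Fin n ≃ V) (i : ℕ → V)
    (hi : ∀ (k : ℕ) (s : Fin n), i (k * n + s) = σ s) (t : ℕ) (v : V) :
    t ≤ heightSeq σ i t v ∧ heightSeq σ i t v < t + n ∧
      i (heightSeq σ i t v) = v ∧ (heightSeq σ i t v = t ↔ v = i t) := by
  have hmod : ∀ t, i (t + n) = i t := by
    intro t
    have hn : 0 < n := by
      rcases Nat.eq_zero_or_pos n with h | h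
      · subst h; exact (σ.symm v).elim0
      · exact h
    have h1 := hi (t / n) ⟨t % n, Nat.mod_lt _ hn⟩
    have h2 := hi (t / n + 1) ⟨t % n, Nat.mod_lt _ hn⟩
    simp only [Nat.div_add_mod'] at h1
    simp only [add_mul, one_mul] at h2
    rw [h1, ← h2]
    congr 1
    have := Nat.div_add_mod' t n
    omega
  have hinj : ∀ a b, a ≤ b → b < a + n → i a = i b → a = b := by
    intro a b hab hb h
    have hn : 0 < n := by omega
    have e1 := hi (a / n) ⟨a % n, Nat.mod_lt _ hn⟩
    have e2 := hi (b / n) ⟨b % n, Nat.mod_lt _ hn⟩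
    simp only [Nat.div_add_mod'] at e1 e2
    rw [e1, e2] at h
    have h' : a % n = b % n := congrArg Fin.val (σ.injective h)
    have h'' : n ∣ b - a := (Nat.modEq_iff_dvd' hab).mp h'
    have := Nat.eq_zero_of_dvd_of_lt h'' (by omega)
    omega
  have main : t ≤ heightSeq σ i t v ∧ heightSeq σ i t v < t + n ∧ i (heightSeq σ i t v) = v := by
    induction t with
    | zero =>
      refine ⟨Nat.zero_le _, ?_, ?_⟩
      · rw [zero_add]; exact (σ.symm v).2
      · have := hi 0 (σ.symm v)
        simpa [heightSeq] using this
    | succ t ih =>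
      obtain ⟨h1, h2, h3⟩ := ih
      by_cases hv : v = i t
      · have : t = heightSeq σ i t v := hinj _ _ h1 h2 (by rw [h3, hv])
        rw [show heightSeq σ i (t + 1) v = heightSeq σ i t v + n from if_pos hv]
        refine ⟨by omega, by omega, ?_⟩
        rw [hmod, h3]
      · rw [show heightSeq σ i (t + 1) v = heightSeq σ i t v from if_neg hv]
        refine ⟨?_, by omega, h3⟩
        by_contra hcon
        have : heightSeq σ i t v = t := by omega
        rw [this] at h3
        exact hv h3.symm
  obtain ⟨h1, h2, h3⟩ := main
  refine ⟨h1, h2, h3, fun h => ?_, fun h => (hinj _ _ h1 h2 (by rw [h3, h])).symm⟩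
  rw [h] at h3
  exact h3.symm

/-- The positive roots of an oriented simply-laced Dynkin diagram can be ordered compatibly with
the antisymmetrized Euler form. The value `f x` is the number of sink reflections after which `x`
becomes the simple root at the current sink, where the sign of the form is visible. -/
theorem IsPosCartan.exists_root_order {C : Matrix V V ℤ} (hC : IsPosCartan C) {n : ℕ}
    (σ : Fin n ≃ V) :
    ∃ f : (V → ℤ) → ℕ, ∀ x y : V → ℤ, 0 ≤ x → 0 ≤ y →
      Matrix.toBilin' C x x = 2 → Matrix.toBilin' C y y = 2 →
      (f x = f y → x = y) ∧
      (f x < f y → Matrix.toBilin' (orient C fun v => σ.symm v) x y ≤ 0) := by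
  rcases Nat.eq_zero_or_pos n with hn | hn
  · subst hn
    refine ⟨fun _ => 0, fun x y _ _ _ _ => ⟨fun _ => ?_, fun h => absurd h (lt_irrefl _)⟩⟩
    ext v
    exact (σ.symm v).elim0
  let i : ℕ → V := fun t => σ ⟨t % n, Nat.mod_lt _ hn⟩
  have hi : ∀ (k : ℕ) (s : Fin n), i (k * n + s) = σ s := by
    intro k s
    have : (k * n + (s : ℕ)) % n = s := by
      rw [Nat.mul_add_mod', Nat.mod_eq_of_lt s.2]
    simp only [i, this]
  have hinv : ∀ t x y, Matrix.toBilin' (orient C (heightSeq σ i t)) (reflSeq C i t x)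
      (reflSeq C i t y) = Matrix.toBilin' (orient C fun v => σ.symm v) x y := by
    intro t x y
    induction t with
    | zero => rfl
    | succ t ih =>
      rw [← ih, reflSeq_succ, reflSeq_succ]
      have hb := heightSeq_bounds σ i hi t
      have hit : heightSeq σ i t (i t) = t := (hb (i t)).2.2.2.mpr rfl
      have hne : ∀ j, j ≠ i t → heightSeq σ i (t + 1) j = heightSeq σ i t j :=
        fun j hj => if_neg hj
      refine hC.orient_reflection (fun j hj => ?_) hne (fun j hj => ?_) _ _
      · rw [hit]
        exact lt_of_le_of_ne (hb j).1 fun h => hj ((hb j).2.2.2.mp h.symm)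
      · rw [hne j hj, show heightSeq σ i (t + 1) (i t) = heightSeq σ i t (i t) + n from if_pos rfl,
          hit]
        exact (hb j).2.1
  let S : (V → ℤ) → Set ℕ := fun x => {t | reflSeq C i t x = Pi.single (i t) 1}
  have hmem : ∀ x, 0 ≤ x → Matrix.toBilin' C x x = 2 → sInf (S x) ∈ S x := fun x h0 hx =>
    Nat.sInf_mem (hC.exists_reflSeq_eq_single σ i hi hx h0)
  refine ⟨fun x => sInf (S x), fun x y hx0 hy0 hx hy => ⟨fun h => ?_, fun h => ?_⟩⟩
  · have h1 : reflSeq C i (sInf (S x)) x = _ := hmem x hx0 hx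
    have h2 : reflSeq C i (sInf (S y)) y = _ := hmem y hy0 hy
    rw [← show sInf (S x) = sInf (S y) from h] at h2
    exact hC.reflSeq_injective i _ (h1.trans h2.symm)
  · have h1 : reflSeq C i (sInf (S x)) x = _ := hmem x hx0 hx
    have hb := heightSeq_bounds σ i hi (sInf (S x))
    have hnn : 0 ≤ reflSeq C i (sInf (S x)) y :=
      hC.reflSeq_nonneg i hy hy0 fun s hs => Nat.notMem_of_lt_sInf (hs.trans h)
    rw [← hinv (sInf (S x)), h1, toBilin'_single_left]
    refine Finset.sum_nonpos fun j _ => mul_nonpos_of_nonpos_of_nonneg ?_ (hnn j)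
    by_cases hj : j = i (sInf (S x))
    · rw [hj, orient_apply, if_neg (lt_irrefl _), if_neg (lt_irrefl _)]
    · have hlt : heightSeq σ i (sInf (S x)) (i (sInf (S x))) < heightSeq σ i (sInf (S x)) j := by
        rw [(hb (i (sInf (S x)))).2.2.2.mpr rfl]
        exact lt_of_le_of_ne (hb j).1 fun h => hj ((hb j).2.2.2.mp h.symm)
      rw [orient_apply, if_neg (by omega), if_pos hlt]
      exact hC.off_diag _ _ (Ne.symm hj)

end Orientation

/-! ### Positive definiteness of the Dynkin diagrams -/

section Weight

variable {V : Type u} [Fintype V] [DecidableEq V]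

/-- A positive vector `w` with `C w ≥ 0`, strictly somewhere in every connected component, forces
positive definiteness. With `x = w y` the form is
`∑ i, wᵢ (C w)ᵢ yᵢ² - (1 / 2) ∑ i j, C i j wᵢ wⱼ (yᵢ - yⱼ)²`, a sum of nonnegative terms. -/
theorem form_pos_of_weight {C : Matrix V V ℤ} (hsymm : ∀ i j, C i j = C j i)
    (hoff : ∀ i j, i ≠ j → C i j ≤ 0) (w : V → ℤ) (hw : ∀ i, 0 < w i)
    (hCw : ∀ i, 0 ≤ ∑ j, C i j * w j)
    (hconn : ∀ i, ∃ k, 0 < ∑ j, C k j * w j ∧ Relation.ReflTransGen (fun a b => C a b < 0) k i)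
    (x : V → ℤ) (hx : x ≠ 0) : 0 < Matrix.toBilin' C x x := by
  by_contra hcon
  push Not at hcon
  let y : V → ℚ := fun i => x i / w i
  have hw' : ∀ i, (0 : ℚ) < w i := fun i => by exact_mod_cast hw i
  have hy : ∀ i, (x i : ℚ) = w i * y i := fun i => (mul_div_cancel₀ _ (hw' i).ne').symm
  let a : V → ℚ := fun i => w i * y i ^ 2 * ∑ j, C i j * w j
  let b : V → V → ℚ := fun i j => -(C i j * w i * w j * (y i - y j) ^ 2)
  have ha : ∀ i, 0 ≤ a i := by
    intro i
    have h1 : (0 : ℚ) ≤ ∑ j, C i j * w j := by exact_mod_cast hCw i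
    have := (hw' i).le
    positivity
  have hb : ∀ i j, 0 ≤ b i j := by
    intro i j
    by_cases hij : i = j
    · subst hij; simp [b]
    · have h1 : (0 : ℚ) ≤ -C i j := by exact_mod_cast neg_nonneg.mpr (hoff i j hij)
      have h2 := (hw' i).le
      have h3 := (hw' j).le
      have : 0 ≤ -(C i j : ℚ) * w i * w j * (y i - y j) ^ 2 := by positivity
      simp only [b]
      linarith
  have hid : 2 * (Matrix.toBilin' C x x : ℚ) = 2 * ∑ i, a i + ∑ i, ∑ j, b i j := by
    have h1 : ∑ i, ∑ j, (C i j * w i * w j * y j ^ 2 : ℚ) = ∑ i, a i := by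
      rw [Finset.sum_comm]
      refine Finset.sum_congr rfl fun i _ => ?_
      simp only [a]
      rw [Int.cast_sum, Finset.mul_sum]
      refine Finset.sum_congr rfl fun j _ => ?_
      rw [hsymm j i]; push_cast; ring
    have h2 : ∑ i, ∑ j, (C i j * w i * w j * y i ^ 2 : ℚ) = ∑ i, a i := by
      refine Finset.sum_congr rfl fun i _ => ?_
      simp only [a]
      rw [Int.cast_sum, Finset.mul_sum]
      refine Finset.sum_congr rfl fun j _ => ?_
      push_cast; ring
    have h3 : (Matrix.toBilin' C x x : ℚ) = ∑ i, ∑ j, (C i j * w i * w j * (y i * y j) : ℚ) := by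
      rw [Matrix.toBilin'_apply]
      push_cast
      refine Finset.sum_congr rfl fun i _ => Finset.sum_congr rfl fun j _ => ?_
      rw [hy i, hy j]; ring
    rw [h3, two_mul (∑ i, a i)]
    nth_rewrite 1 [← h1]
    rw [← h2]
    simp only [Finset.mul_sum, ← Finset.sum_add_distrib, b]
    refine Finset.sum_congr rfl fun i _ => Finset.sum_congr rfl fun j _ => ?_
    ring
  have hQ : (Matrix.toBilin' C x x : ℚ) ≤ 0 := by exact_mod_cast hcon
  have hA : 0 ≤ ∑ i, a i := Finset.sum_nonneg fun i _ => ha i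
  have hB : 0 ≤ ∑ i, ∑ j, b i j := Finset.sum_nonneg fun i _ => Finset.sum_nonneg fun j _ => hb i j
  have hA0 : ∑ i, a i = 0 := by linarith
  have hB0 : ∑ i, ∑ j, b i j = 0 := by linarith
  have ha0 : ∀ i, a i = 0 := fun i =>
    (Finset.sum_eq_zero_iff_of_nonneg fun i _ => ha i).mp hA0 i (Finset.mem_univ i)
  have hb0 : ∀ i j, b i j = 0 := fun i j =>
    (Finset.sum_eq_zero_iff_of_nonneg fun j _ => hb i j).mp
      ((Finset.sum_eq_zero_iff_of_nonneg fun i _ => Finset.sum_nonneg fun j _ => hb i j).mp hB0 i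
        (Finset.mem_univ i)) j (Finset.mem_univ j)
  refine hx (funext fun i => ?_)
  obtain ⟨k, hk, hki⟩ := hconn i
  have hyi : y i = 0 := by
    induction hki with
    | refl =>
      have h1 : (0 : ℚ) < ∑ j, C k j * w j := by exact_mod_cast hk
      have h2 := ha0 k
      simp only [a, mul_eq_zero] at h2
      rcases h2 with (h2 | h2) | h2
      · exact absurd h2 (hw' k).ne'
      · exact pow_eq_zero_iff (two_ne_zero) |>.mp h2
      · exact absurd h2 h1.ne'
    | @tail p q _ hpq ih =>
      have h2 := hb0 p q
      have h3 : (C p q : ℚ) ≠ 0 := by exact_mod_cast hpq.ne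
      simp only [b, neg_eq_zero, mul_eq_zero] at h2
      rcases h2 with ((h2 | h2) | h2) | h2
      · exact absurd h2 h3
      · exact absurd h2 (hw' p).ne'
      · exact absurd h2 (hw' q).ne'
      · have := pow_eq_zero_iff (two_ne_zero) |>.mp h2
        rw [ih] at this
        linarith
  have h1 := hy i
  rw [hyi, mul_zero] at h1
  exact_mod_cast h1

end Weight

/-- A matrix with diagonal `2` whose diagram is connected and which admits a positive vector with
nonnegative and nonzero image. All the Dynkin diagrams of type `A`, `D` and `E` are of this
kind. -/
structure IsConnectedPosWeight {n : ℕ} (M : Matrix (Fin n) (Fin n) ℤ) : Prop where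
  diag : ∀ i, M i i = 2
  conn : ∀ i j, Relation.ReflTransGen (fun a b => M a b < 0) i j
  weight : ∃ w : Fin n → ℤ, (∀ i, 0 < w i) ∧ (∀ i, 0 ≤ ∑ j, M i j * w j) ∧
    ∃ k, 0 < ∑ j, M k j * w j

/-- A graph is connected if every vertex but the root has a neighbour of smaller rank. -/
theorem reflTransGen_of_rank {α : Type*} {r : α → α → Prop} (hr : ∀ a b, r a b → r b a)
    (rk : α → ℕ) (root : α) (h : ∀ a, a ≠ root → ∃ b, rk b < rk a ∧ r b a) (a b : α) :
    Relation.ReflTransGen r a b := by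
  have key : ∀ m a, rk a = m → Relation.ReflTransGen r root a := by
    intro m
    induction m using Nat.strong_induction_on with
    | _ m ih =>
      intro a ha
      by_cases hroot : a = root
      · rw [hroot]
      · obtain ⟨b, hb, hba⟩ := h a hroot
        exact (ih _ (ha ▸ hb) b rfl).tail hba
  have : Std.Symm r := ⟨hr⟩
  exact (Relation.ReflTransGen.stdSymm.symm _ _ (key _ a rfl)).trans (key _ b rfl)

theorem sum_ite_val_le {n : ℕ} (c : ℕ) {z : ℤ} (hz : 0 ≤ z) :
    ∑ j : Fin n, (if (j : ℕ) = c then z else 0) ≤ z := by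
  by_cases hc : c < n
  · rw [Finset.sum_eq_single (⟨c, hc⟩ : Fin n)]
    · simp
    · intro j _ hj
      rw [if_neg fun h => hj (Fin.ext h)]
    · simp
  · rw [Finset.sum_eq_zero]
    · exact hz
    · intro j _
      rw [if_neg]
      have := j.2
      omega

/-- A lower bound for a sum over `Fin n` from a bound by point masses at `a`, `b`, `c`, `d`. -/
theorem sub_le_sum_of_point_masses {n : ℕ} (f : Fin n → ℤ) (a : Fin n) (b c d : ℕ)
    {p q r s : ℤ} (hq : 0 ≤ q) (hr : 0 ≤ r) (hs : 0 ≤ s)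
    (hf : ∀ j : Fin n, (if j = a then p else 0) - (if (j : ℕ) = b then q else 0)
      - (if (j : ℕ) = c then r else 0) - (if (j : ℕ) = d then s else 0) ≤ f j) :
    p - q - r - s ≤ ∑ j, f j := by
  have h1 := Finset.sum_le_sum fun j (_ : j ∈ Finset.univ) => hf j
  simp only [Finset.sum_sub_distrib, Finset.sum_ite_eq', Finset.mem_univ, if_true] at h1
  have h2 := sum_ite_val_le (n := n) b hq
  have h3 := sum_ite_val_le (n := n) c hr
  have h4 := sum_ite_val_le (n := n) d hs
  linarith

theorem isConnectedPosWeight_A {n : ℕ} (hn : 1 ≤ n) : IsConnectedPosWeight (CartanMatrix.A n) where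
  diag i := by simp [CartanMatrix.A]
  conn := by
    refine reflTransGen_of_rank (fun a b h => ?_) (fun a => (a : ℕ)) ⟨0, hn⟩ fun a ha => ?_
    · rwa [← CartanMatrix.A_isSymm n |>.apply]
    · have ha' : (a : ℕ) ≠ 0 := fun h => ha (Fin.ext h)
      refine ⟨⟨a - 1, by omega⟩, by simp only; omega, ?_⟩
      simp only [CartanMatrix.A, Matrix.of_apply, Fin.ext_iff]
      split_ifs <;> omega
  weight := by
    refine ⟨fun _ => 1, fun _ => one_pos, fun i => ?_, ⟨0, hn⟩, ?_⟩
    · refine le_trans (by norm_num) (sub_le_sum_of_point_masses _ i (i + 1) (i - 1) 0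
        (p := 2) (q := 1) (r := 1) (s := 0) (by norm_num) (by norm_num) le_rfl fun j => ?_)
      simp only [CartanMatrix.A, Matrix.of_apply, Fin.ext_iff]
      split_ifs <;> omega
    · refine lt_of_lt_of_le (by norm_num) (sub_le_sum_of_point_masses _ ⟨0, hn⟩ 1 0 0
        (p := 2) (q := 1) (r := 0) (s := 0) (by norm_num) le_rfl le_rfl fun j => ?_)
      simp only [CartanMatrix.A, Matrix.of_apply, Fin.ext_iff]
      grind

theorem cartanMatrix_D_apply {n : ℕ} (hn : 4 ≤ n) (i j : Fin n) : CartanMatrix.D n i j =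
    if (i : ℕ) = j then 2
    else if ((i : ℕ) + 1 = j ∧ (j : ℕ) + 1 < n) ∨ ((j : ℕ) + 1 = i ∧ (i : ℕ) + 1 < n) ∨
      ((i : ℕ) + 3 = n ∧ (j : ℕ) + 1 = n) ∨ ((j : ℕ) + 3 = n ∧ (i : ℕ) + 1 = n) then -1
    else 0 := by
  simp only [CartanMatrix.D, Matrix.of_apply, Fin.ext_iff]
  grind

theorem isConnectedPosWeight_D {n : ℕ} (hn : 4 ≤ n) : IsConnectedPosWeight (CartanMatrix.D n) where
  diag i := by simp
  conn := by
    refine reflTransGen_of_rank (fun a b h => ?_) (fun a => (a : ℕ)) ⟨0, by omega⟩ fun a ha => ?_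
    · rwa [← CartanMatrix.D_isSymm n |>.apply]
    · have ha' : (a : ℕ) ≠ 0 := fun h => ha (Fin.ext h)
      by_cases hlast : (a : ℕ) + 1 = n
      · refine ⟨⟨a - 2, by omega⟩, by simp only; omega, ?_⟩
        rw [cartanMatrix_D_apply hn, if_neg (by simp only; omega), if_pos (by simp only; omega)]
        norm_num
      · refine ⟨⟨a - 1, by omega⟩, by simp only; omega, ?_⟩
        rw [cartanMatrix_D_apply hn, if_neg (by simp only; omega), if_pos (by simp only; omega)]
        norm_num
  weight := by
    -- constant along the chain, and half of that at the two short ends of the fork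
    refine ⟨fun j => if (j : ℕ) + 2 < n then 2 else 1, fun i => ?_, fun i => ?_,
      ⟨0, by omega⟩, ?_⟩
    · dsimp only
      split_ifs <;> norm_num
    · rcases lt_trichotomy ((i : ℕ) + 3) n with hi | hi | hi
      · refine le_trans (by norm_num) (sub_le_sum_of_point_masses _ i (i + 1) (i - 1) 0
          (p := 4) (q := 2) (r := 2) (s := 0) (by norm_num) (by norm_num) le_rfl fun j => ?_)
        rw [cartanMatrix_D_apply hn]
        grind
      · refine le_trans (by norm_num) (sub_le_sum_of_point_masses _ i (i + 1) (i - 1) (i + 2)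
          (p := 4) (q := 1) (r := 2) (s := 1) (by norm_num) (by norm_num) (by norm_num) fun j => ?_)
        rw [cartanMatrix_D_apply hn]
        grind
      · refine le_trans (by norm_num) (sub_le_sum_of_point_masses _ i (n - 3) 0 0
          (p := 2) (q := 2) (r := 0) (s := 0) (by norm_num) le_rfl le_rfl fun j => ?_)
        rw [cartanMatrix_D_apply hn]
        grind
    · refine lt_of_lt_of_le (by norm_num) (sub_le_sum_of_point_masses _ ⟨0, by omega⟩ 1 0 0
        (p := 4) (q := 2) (r := 0) (s := 0) (by norm_num) le_rfl le_rfl fun j => ?_)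
      rw [cartanMatrix_D_apply hn]
      grind

-- For the exceptional types the weight is the highest root.

theorem isConnectedPosWeight_E₆ : IsConnectedPosWeight CartanMatrix.E₆ where
  diag := CartanMatrix.E₆_diag
  conn := reflTransGen_of_rank (fun a b h => by rwa [← CartanMatrix.E₆_isSymm.apply])
    (fun a => 6 - (a : ℕ)) 5 (by decide)
  weight := ⟨![1, 2, 2, 3, 2, 1], by decide, by decide, 1, by decide⟩

theorem isConnectedPosWeight_E₇ : IsConnectedPosWeight CartanMatrix.E₇ where
  diag := CartanMatrix.E₇_diag
  conn := reflTransGen_of_rank (fun a b h => by rwa [← CartanMatrix.E₇_isSymm.apply])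
    (fun a => 7 - (a : ℕ)) 6 (by decide)
  weight := ⟨![2, 2, 3, 4, 3, 2, 1], by decide, by decide, 0, by decide⟩

theorem isConnectedPosWeight_E₈ : IsConnectedPosWeight CartanMatrix.E₈ where
  diag := CartanMatrix.E₈_diag
  conn := reflTransGen_of_rank (fun a b h => by rwa [← CartanMatrix.E₈_isSymm.apply])
    (fun a => 8 - (a : ℕ)) 7 (by decide)
  weight := ⟨![2, 3, 4, 6, 5, 4, 3, 2], by decide, by decide, 7, by decide⟩

namespace Subquiver

variable {V : Type u} [Quiver.{v} V]

theorem arrows_eq_empty_of_tail {S : Subquiver V} {i j : V} (h : i ∉ S.verts) :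
    S.arrows i j = ∅ :=
  Set.eq_empty_of_forall_notMem fun _ ha => h (S.tail_mem ha)

theorem arrows_eq_empty_of_head {S : Subquiver V} {i j : V} (h : j ∉ S.verts) :
    S.arrows i j = ∅ :=
  Set.eq_empty_of_forall_notMem fun _ ha => h (S.head_mem ha)

variable [DecidableEq V]

theorem cartan_comm (S : Subquiver V) (i j : V) : S.cartan i j = S.cartan j i := by
  simp only [cartan, eq_comm (a := i)]
  ring

theorem cartan_of_notMem {S : Subquiver V} {i j : V} (h : i ∉ S.verts) :
    S.cartan i j = if i = j then 2 else 0 := by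
  simp [cartan, arrows_eq_empty_of_tail h, arrows_eq_empty_of_head h]

theorem cartan_nonpos (S : Subquiver V) {i j : V} (h : i ≠ j) : S.cartan i j ≤ 0 := by
  simp only [cartan, if_neg h]
  omega

theorem mem_verts_of_cartan_neg {S : Subquiver V} {i j : V} (h : S.cartan i j < 0) :
    i ∈ S.verts := by
  by_contra hi
  rw [cartan_of_notMem hi] at h
  split_ifs at h <;> omega

/-- The Cartan matrix of a subquiver, with the vertices outside the subquiver as isolated
vertices. -/
noncomputable def cartanMatrix (S : Subquiver V) : Matrix V V ℤ := Matrix.of S.cartan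

theorem cartanMatrix_apply (S : Subquiver V) (i j : V) : S.cartanMatrix i j = S.cartan i j := rfl

theorem IsDynkin.exists_hasType {S : Subquiver V} (hS : S.IsDynkin) :
    ∃ (n : ℕ) (M : Matrix (Fin n) (Fin n) ℤ), IsConnectedPosWeight M ∧ S.HasType M := by
  rcases hS with ⟨n, hn, h⟩ | ⟨n, hn, h⟩ | h | h | h
  · exact ⟨n, _, isConnectedPosWeight_A hn, h⟩
  · exact ⟨n, _, isConnectedPosWeight_D hn, h⟩
  · exact ⟨6, _, isConnectedPosWeight_E₆, h⟩
  · exact ⟨7, _, isConnectedPosWeight_E₇, h⟩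
  · exact ⟨8, _, isConnectedPosWeight_E₈, h⟩

theorem IsDynkin.nonempty {S : Subquiver V} (hS : S.IsDynkin) : S.verts.Nonempty := by
  obtain ⟨n, M, hM, e, -⟩ := hS.exists_hasType
  obtain ⟨w, -, -, k, -⟩ := hM.weight
  exact ⟨e k, (e k).2⟩

theorem IsDynkin.connected {S : Subquiver V} (hS : S.IsDynkin) {i j : V} (hi : i ∈ S.verts)
    (hj : j ∈ S.verts) : Relation.ReflTransGen (fun a b => S.cartan a b < 0) i j := by
  obtain ⟨n, M, hM, e, he⟩ := hS.exists_hasType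
  have h := hM.conn (e.symm ⟨i, hi⟩) (e.symm ⟨j, hj⟩)
  have h' := h.lift (p := fun a b => S.cartan a b < 0) (fun a => (e a : V)) fun a b hab => by
    change S.cartan _ _ < 0
    rw [he]; exact hab
  change Relation.ReflTransGen _ (e (e.symm ⟨i, hi⟩) : V) (e (e.symm ⟨j, hj⟩) : V) at h'
  simpa using h'

theorem IsDynkin.isPosCartan [Fintype V] {S : Subquiver V} (hS : S.IsDynkin) :
    IsPosCartan S.cartanMatrix := by
  obtain ⟨n, M, hM, e, he⟩ := hS.exists_hasType
  obtain ⟨w, hw, hMw, k, hk⟩ := hM.weight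
  have hmem : ∀ i (hi : i ∈ S.verts), (e (e.symm ⟨i, hi⟩) : V) = i := fun i hi => by simp
  classical
  let w' : V → ℤ := fun i => if hi : i ∈ S.verts then w (e.symm ⟨i, hi⟩) else 1
  have hw'e : ∀ a, w' (e a) = w a := fun a => by
    simp only [w', dif_pos (e a).2, Subtype.coe_eta, Equiv.symm_apply_apply]
  have hin : ∀ a, ∑ j, S.cartanMatrix (e a) j * w' j = ∑ b, M a b * w b := by
    intro a
    rw [← Finset.sum_subset (Finset.subset_univ (Finset.univ.map
      (e.toEmbedding.trans (Function.Embedding.subtype _)))), Finset.sum_map]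
    · refine Finset.sum_congr rfl fun b _ => ?_
      change S.cartan (e a) (e b) * w' (e b) = _
      rw [he, hw'e]
    · intro j _ hj
      have hj' : j ∉ S.verts := fun hj' => hj (by
        simp only [Finset.mem_map, Finset.mem_univ, true_and]
        exact ⟨e.symm ⟨j, hj'⟩, hmem j hj'⟩)
      rw [cartanMatrix_apply, cartan_comm, cartan_of_notMem hj', if_neg, zero_mul]
      rintro rfl
      exact hj' (e a).2
  have hout : ∀ i ∉ S.verts, ∑ j, S.cartanMatrix i j * w' j = 2 := by
    intro i hi
    simp only [cartanMatrix_apply, cartan_of_notMem hi, w', ite_mul, zero_mul, Finset.sum_ite_eq,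
      Finset.mem_univ, if_true, dif_neg hi, mul_one]
  refine ⟨S.cartan_comm, fun i => ?_, fun i j => S.cartan_nonpos,
    form_pos_of_weight S.cartan_comm (fun i j => S.cartan_nonpos) w' ?_ ?_ ?_⟩
  · by_cases hi : i ∈ S.verts
    · rw [cartanMatrix_apply, ← hmem i hi, he, hM.diag]
    · rw [cartanMatrix_apply, cartan_of_notMem hi, if_pos rfl]
  · intro i
    simp only [w']
    split_ifs
    · exact hw _
    · exact one_pos
  · intro i
    by_cases hi : i ∈ S.verts
    · rw [← hmem i hi, hin]; exact hMw _
    · rw [hout i hi]; norm_num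
  · intro i
    by_cases hi : i ∈ S.verts
    · exact ⟨e k, by rw [hin]; exact hk, hS.connected (e k).2 hi⟩
    · exact ⟨i, by rw [hout i hi]; norm_num, .refl⟩

end Subquiver

/-! ### Enumerations and heights -/

theorem exists_sorted_equiv {X L : Type*} [Finite X] [LinearOrder L] (g : X → L)
    (hg : Function.Injective g) :
    ∃ φ : Fin (Nat.card X) ≃ X, ∀ a b, a < b → g (φ a) < g (φ b) := by
  have := Fintype.ofFinite X
  let _ : LinearOrder X := LinearOrder.lift' g hg
  let e : Fin (Nat.card X) ≃o X := Fintype.orderIsoFinOfCardEq X Fintype.card_eq_nat_card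
  exact ⟨e.toEquiv, fun a b h => e.strictMono h⟩

theorem isAcyclic_of_height {W : Type u} [Quiver.{v} W] (f : W → ℕ)
    (hf : ∀ i j : W, Nonempty (i ⟶ j) → f j < f i) : IsAcyclic W := by
  have key : ∀ (i j : W) (p : Quiver.Path i j), f j ≤ f i ∧ (p.length ≠ 0 → f j < f i) := by
    intro i j p
    induction p with
    | nil => exact ⟨le_rfl, fun h => absurd rfl h⟩
    | cons p a ih => exact ⟨((hf _ _ ⟨a⟩).trans_le ih.1).le, fun _ => (hf _ _ ⟨a⟩).trans_le ih.1⟩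
  intro i p
  by_contra h
  exact lt_irrefl _ ((key i i p).2 h)

/-- The vertices of a finite acyclic quiver can be given distinct heights that decrease along the
arrows: refine the number of vertices that can be reached. -/
theorem IsAcyclic.exists_height {W : Type u} [Quiver.{v} W] [Finite W] (h : IsAcyclic W) :
    ∃ f : W → ℕ, Function.Injective f ∧ ∀ i j : W, Nonempty (i ⟶ j) → f j < f i := by
  let R : W → Set W := fun i => {k | Nonempty (Quiver.Path i k)}
  obtain ⟨n, ⟨e⟩⟩ := Finite.exists_equiv_fin W
  have hR : ∀ i j : W, Nonempty (i ⟶ j) → (R j).ncard < (R i).ncard := by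
    rintro i j ⟨a⟩
    refine Set.ncard_lt_ncard ⟨fun k ⟨p⟩ => ⟨a.toPath.comp p⟩, fun hsub => ?_⟩ (Set.toFinite _)
    obtain ⟨p⟩ := hsub (show i ∈ R i from ⟨Quiver.Path.nil⟩)
    simpa using h j (p.cons a)
  refine ⟨fun i => (R i).ncard * n + e i, fun i j hij => e.injective (Fin.ext ?_), fun i j ha => ?_⟩
  · have h1 := congrArg (· % n) hij
    simp only [Nat.mul_add_mod', Nat.mod_eq_of_lt (e i).2, Nat.mod_eq_of_lt (e j).2] at h1
    exact h1
  · have h1 := Nat.mul_le_mul_right n (hR i j ha)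
    have h2 := (e j).2
    simp only [Nat.succ_mul] at h1 ⊢
    omega

theorem IsAcyclic.exists_equiv_fin {W : Type u} [Quiver.{v} W] [Finite W] (h : IsAcyclic W) :
    ∃ σ : Fin (Nat.card W) ≃ W, ∀ i j : W, Nonempty (i ⟶ j) → σ.symm j < σ.symm i := by
  obtain ⟨f, hf, hlt⟩ := h.exists_height
  obtain ⟨σ, hσ⟩ := exists_sorted_equiv f hf
  refine ⟨σ, fun i j ha => ?_⟩
  by_contra hcon
  rcases (not_lt.mp hcon).eq_or_lt with heq | hlt'
  · rw [σ.symm.injective heq] at ha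
    exact lt_irrefl _ (hlt _ _ ha)
  · have := hσ _ _ hlt'
    rw [Equiv.apply_symm_apply, Equiv.apply_symm_apply] at this
    exact lt_asymm this (hlt _ _ ha)

/-! ### The antisymmetrized Euler form -/

section Lam

variable {V : Type u} [Fintype V] [Quiver.{v} V]

/-- A vector of natural numbers, as a vector of integers. -/
def intVec {V : Type u} (γ : V → ℕ) : V → ℤ := fun i => (γ i : ℤ)

theorem intVec_injective {V : Type u} : Function.Injective (intVec (V := V)) := fun x y h => by
  ext i
  have : ((x i : ℕ) : ℤ) = y i := congrFun h i
  exact_mod_cast this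

theorem lam_eq_sum (A : WideSubquiver V) (x y : V → ℕ) :
    lam A x y = ∑ i, ∑ j, (((A i j).ncard : ℤ) - (A j i).ncard) * ((x i : ℤ) * y j) := by
  have h1 : ∑ i, ∑ j, ((A j i).ncard : ℤ) * ((x i : ℤ) * y j)
      = ∑ i, ∑ j, ((A i j).ncard : ℤ) * ((y i : ℤ) * x j) := by
    rw [Finset.sum_comm]
    exact Finset.sum_congr rfl fun i _ => Finset.sum_congr rfl fun j _ => by ring
  simp only [sub_mul, Finset.sum_sub_distrib, h1, lam, eulerForm]
  have h2 : ∑ i, (y i : ℤ) * x i = ∑ i, (x i : ℤ) * y i :=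
    Finset.sum_congr rfl fun i _ => mul_comm _ _
  rw [h2]; ring

theorem lam_antisymm (A : WideSubquiver V) (x y : V → ℕ) : lam A x y = -lam A y x := by
  simp only [lam]; ring

/-- If no arrow of `A` runs from the support of `x` to the support of `y`, then all contributions
to `λ_A(x, y)` are nonpositive. -/
theorem lam_nonpos {A : WideSubquiver V} {x y : V → ℕ}
    (h : ∀ i j, x i ≠ 0 → y j ≠ 0 → A i j = ∅) : lam A x y ≤ 0 := by
  rw [lam_eq_sum]
  refine Finset.sum_nonpos fun i _ => Finset.sum_nonpos fun j _ => ?_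
  by_cases hx : x i = 0
  · simp [hx]
  by_cases hy : y j = 0
  · simp [hy]
  rw [h i j hx hy, Set.ncard_empty]
  refine mul_nonpos_of_nonpos_of_nonneg (by simp) (by positivity)

theorem lam_neg [∀ i j : V, Finite (i ⟶ j)] {A : WideSubquiver V} {x y : V → ℕ}
    (h : ∀ i j, x i ≠ 0 → y j ≠ 0 → A i j = ∅) {i₀ j₀ : V} (hx₀ : x i₀ ≠ 0) (hy₀ : y j₀ ≠ 0)
    (hA : (A j₀ i₀).Nonempty) : lam A x y < 0 := by
  rw [lam_eq_sum]
  have hterm : ∀ i j, (((A i j).ncard : ℤ) - (A j i).ncard) * ((x i : ℤ) * y j) ≤ 0 := by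
    intro i j
    by_cases hx : x i = 0
    · simp [hx]
    by_cases hy : y j = 0
    · simp [hy]
    rw [h i j hx hy, Set.ncard_empty]
    refine mul_nonpos_of_nonpos_of_nonneg (by simp) (by positivity)
  refine Finset.sum_neg' (fun i _ => Finset.sum_nonpos fun j _ => hterm i j)
    ⟨i₀, Finset.mem_univ _, Finset.sum_neg' (fun j _ => hterm i₀ j) ⟨j₀, Finset.mem_univ _, ?_⟩⟩
  have h1 : 0 < (A j₀ i₀).ncard := (Set.ncard_pos (Set.toFinite _)).mpr hA
  have h2 : 0 < x i₀ := Nat.pos_of_ne_zero hx₀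
  have h3 : 0 < y j₀ := Nat.pos_of_ne_zero hy₀
  rw [h i₀ j₀ hx₀ hy₀, Set.ncard_empty]
  refine mul_neg_of_neg_of_pos (by omega) (by positivity)

theorem lam_eq_zero {A : WideSubquiver V} {x y : V → ℕ}
    (h : ∀ i j, x i ≠ 0 → y j ≠ 0 → A i j = ∅ ∧ A j i = ∅) : lam A x y = 0 := by
  refine le_antisymm (lam_nonpos fun i j hx hy => (h i j hx hy).1) ?_
  rw [lam_antisymm, neg_nonneg]
  exact lam_nonpos fun j i hy hx => (h i j hx hy).2

theorem lam_top [∀ i j : V, Finite (i ⟶ j)] (A : WideSubquiver V) (x y : V → ℕ) :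
    lam ⊤ x y = lam A x y + lam (arrowCompl A) x y := by
  have h : ∀ i j : V, (((⊤ : WideSubquiver V) i j).ncard : ℤ) =
      (A i j).ncard + (arrowCompl A i j).ncard := by
    intro i j
    rw [show (⊤ : WideSubquiver V) i j = Set.univ from rfl, Set.ncard_univ,
      ← Set.ncard_add_ncard_compl (A i j)]
    push_cast
    rfl
  simp only [lam_eq_sum, h, ← Finset.sum_add_distrib]
  exact Finset.sum_congr rfl fun i _ => Finset.sum_congr rfl fun j _ => by ring

end Lam

/-! ### Positive roots of a Dynkin subquiver -/

section Roots

variable {V : Type u} [Fintype V] [DecidableEq V] [Quiver.{v} V]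

/-- If the arrows decrease the height `h`, the antisymmetrized Euler form of a Dynkin subquiver is
the one of its Cartan matrix oriented by `h`. -/
theorem lam_arrows_eq (S : Subquiver V) {h : V → ℕ}
    (hh : ∀ i j : V, Nonempty (i ⟶ j) → h j < h i) (x y : V → ℕ) :
    lam S.arrows x y = Matrix.toBilin' (orient S.cartanMatrix h) (intVec x) (intVec y) := by
  rw [lam_eq_sum, Matrix.toBilin'_apply]
  refine Finset.sum_congr rfl fun i _ => Finset.sum_congr rfl fun j _ => ?_
  have hempty : ∀ i j, ¬ h j < h i → S.arrows i j = ∅ := fun i j hij =>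
    Set.eq_empty_of_forall_notMem fun a _ => hij (hh i j ⟨a⟩)
  have key : ((S.arrows i j).ncard : ℤ) - (S.arrows j i).ncard = orient S.cartanMatrix h i j := by
    rw [orient_apply, Subquiver.cartanMatrix_apply, Subquiver.cartan]
    split_ifs with h1 h2 h3 h2
    · subst h2; omega
    · rw [hempty j i (by omega), Set.ncard_empty]; simp
    · subst h2; omega
    · rw [hempty i j h1, Set.ncard_empty]; simp
    · rw [hempty i j h1, hempty j i h3, Set.ncard_empty]; simp
  rw [key]
  simp only [intVec]
  ring

namespace Subquiver

variable {S : Subquiver V}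

theorem IsRoot.form_self (hS : S.IsDynkin) {β : V → ℤ} (hβ : S.IsRoot β) :
    Matrix.toBilin' S.cartanMatrix β β = 2 := by
  induction hβ with
  | simple i _ => exact hS.isPosCartan.form_single_single i
  | reflect i _ β _ ih =>
    rw [← ih, ← hS.isPosCartan.form_reflection i β β, reflection_eq_sub_single]
    rfl

theorem IsRoot.eq_zero_of_notMem {β : V → ℤ} (hβ : S.IsRoot β) {k : V} (hk : k ∉ S.verts) :
    β k = 0 := by
  induction hβ with
  | simple i hi =>
    rw [Pi.single_eq_of_ne]
    rintro rfl
    exact hk hi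
  | reflect i hi β _ ih =>
    rw [Pi.sub_apply, ih, Pi.single_eq_of_ne, sub_zero]
    rintro rfl
    exact hk hi

theorem mem_verts_of_mem_posRoots {β : V → ℕ} (hβ : β ∈ S.posRoots) {k : V} (hk : β k ≠ 0) :
    k ∈ S.verts := by
  by_contra h
  exact hk (by exact_mod_cast IsRoot.eq_zero_of_notMem hβ h)

theorem form_self_of_mem_posRoots (hS : S.IsDynkin) {β : V → ℕ} (hβ : β ∈ S.posRoots) :
    Matrix.toBilin' S.cartanMatrix (intVec β) (intVec β) = 2 :=
  IsRoot.form_self hS hβ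

theorem exists_ne_zero_of_mem_posRoots (hS : S.IsDynkin) {β : V → ℕ} (hβ : β ∈ S.posRoots) :
    ∃ k, β k ≠ 0 := by
  by_contra hcon
  push Not at hcon
  have h := form_self_of_mem_posRoots hS hβ
  rw [show intVec β = 0 from funext fun i => by simp [intVec, hcon i]] at h
  simp at h

theorem finite_posRoots (hS : S.IsDynkin) : S.posRoots.Finite :=
  (hS.isPosCartan.finite_norm_two.preimage intVec_injective.injOn).subset
    fun _ hβ => form_self_of_mem_posRoots hS hβ

theorem single_mem_posRoots {i : V} (hi : i ∈ S.verts) : (Pi.single i 1 : V → ℕ) ∈ S.posRoots := by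
  have h : (fun k => ((Pi.single i 1 : V → ℕ) k : ℤ)) = Pi.single i 1 := by
    ext k
    by_cases hk : k = i
    · subst hk; simp
    · simp [Pi.single_eq_of_ne hk]
  change S.IsRoot _
  rw [h]
  exact IsRoot.simple i hi

theorem exists_posRoots_order (hQ : IsAcyclic V) (hS : S.IsDynkin) :
    ∃ f : (V → ℕ) → ℕ, ∀ x ∈ S.posRoots, ∀ y ∈ S.posRoots,
      (f x = f y → x = y) ∧ (f x < f y → 0 ≤ lam S.arrows y x) := by
  obtain ⟨σ, hσ⟩ := hQ.exists_equiv_fin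
  obtain ⟨f, hf⟩ := hS.isPosCartan.exists_root_order σ
  refine ⟨fun x => f (intVec x), fun x hx y hy => ?_⟩
  obtain ⟨h1, h2⟩ := hf (intVec x) (intVec y) (fun i => Int.natCast_nonneg _)
    (fun i => Int.natCast_nonneg _) (form_self_of_mem_posRoots hS hx)
    (form_self_of_mem_posRoots hS hy)
  refine ⟨fun h => intVec_injective (h1 h), fun h => ?_⟩
  rw [lam_antisymm, neg_nonneg, lam_arrows_eq S (h := fun v => σ.symm v) hσ]
  exact h2 h

end Subquiver

end Roots

namespace DynkinPartition

/-! ### Orderings for admissible partitions -/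

section Contraction

variable {V : Type u} [DecidableEq V] [Quiver.{v} V] {ℓ : ℕ} (P : DynkinPartition V ℓ)

theorem part_unique {i : V} {j j' : Fin ℓ} (h : i ∈ (P.part j).verts) (h' : i ∈ (P.part j').verts) :
    j = j' := by
  by_contra hne
  exact Set.disjoint_left.mp (P.disjoint j j' hne) h h'

/-- The relation "there is an arrow `t ⟶ h`" of the contracted quiver. -/
def ContrAdj (t h : Fin ℓ) : Prop := Nonempty (Quiver.Hom (V := P.Contraction) t h)

theorem contrAdj_iff {t h : Fin ℓ} : P.ContrAdj t h ↔ ∃ (i k : V) (a : i ⟶ k),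
    i ∈ (P.part t).verts ∧ k ∈ (P.part h).verts ∧ ∀ m, a ∉ (P.part m).arrows i k := by
  constructor
  · rintro ⟨⟨⟨i, k, a⟩, h1, h2, h3⟩⟩
    exact ⟨i, k, a, h1, h2, h3⟩
  · rintro ⟨i, k, a, h1, h2, h3⟩
    exact ⟨Subtype.mk ⟨i, k, a⟩ ⟨h1, h2, h3⟩⟩

theorem contrAdj_of_ne {t h : Fin ℓ} (hne : t ≠ h) {i k : V} (a : i ⟶ k)
    (hi : i ∈ (P.part t).verts) (hk : k ∈ (P.part h).verts) : P.ContrAdj t h :=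
  P.contrAdj_iff.mpr ⟨i, k, a, hi, hk, fun _ hm => hne
    ((P.part_unique hi ((P.part _).tail_mem hm)).trans (P.part_unique ((P.part _).head_mem hm) hk))⟩

theorem contrAdj_self {t : Fin ℓ} {i k : V} (a : i ⟶ k) (hi : i ∈ (P.part t).verts)
    (hk : k ∈ (P.part t).verts) (ha : a ∉ (P.part t).arrows i k) : P.ContrAdj t t :=
  P.contrAdj_iff.mpr ⟨i, k, a, hi, hk, fun m hm => by
    obtain rfl := P.part_unique hi ((P.part m).tail_mem hm)
    exact ha hm⟩

variable {P}

theorem IsAdmissible.not_contrAdj_self (hP : P.IsAdmissible) (t : Fin ℓ) : ¬ P.ContrAdj t t := by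
  rintro ⟨a⟩
  exact Nat.succ_ne_zero _ (hP t (Quiver.Path.nil.cons a))

theorem isAdmissible_of_height (f : Fin ℓ → ℕ) (hf : ∀ t h, P.ContrAdj t h → f h < f t) :
    P.IsAdmissible :=
  isAcyclic_of_height (W := P.Contraction) f hf

theorem IsOrdered.isAdmissible (hP : P.IsOrdered) : P.IsAdmissible :=
  isAdmissible_of_height (fun j => (j : ℕ)) hP

theorem IsAdmissible.exists_height (hP : P.IsAdmissible) :
    ∃ f : Fin ℓ → ℕ, Function.Injective f ∧ ∀ t h, P.ContrAdj t h → f h < f t := by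
  have : Finite P.Contraction := inferInstanceAs (Finite (Fin ℓ))
  exact IsAcyclic.exists_height (W := P.Contraction) hP

end Contraction

variable {V : Type u} [Fintype V] [DecidableEq V] [Quiver.{v} V] {ℓ : ℕ} {P : DynkinPartition V ℓ}

theorem posRoots_part_unique {x : V → ℕ} {j j' : Fin ℓ} (h : x ∈ (P.part j).posRoots)
    (h' : x ∈ (P.part j').posRoots) : j = j' := by
  obtain ⟨k, hk⟩ := Subquiver.exists_ne_zero_of_mem_posRoots (P.isDynkin j) h
  exact P.part_unique (Subquiver.mem_verts_of_mem_posRoots h hk)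
    (Subquiver.mem_verts_of_mem_posRoots h' hk)

theorem finite_roots (P : DynkinPartition V ℓ) : P.roots.Finite :=
  Set.finite_iUnion fun j => Subquiver.finite_posRoots (P.isDynkin j)

theorem lam_top_nonpos {j j' : Fin ℓ} (hne : j ≠ j') (hadj : ¬ P.ContrAdj j j') {x y : V → ℕ}
    (hx : x ∈ (P.part j).posRoots) (hy : y ∈ (P.part j').posRoots) : lam ⊤ x y ≤ 0 :=
  lam_nonpos fun _ _ hi hk => Set.eq_empty_of_forall_notMem fun a _ =>
    hadj (P.contrAdj_of_ne hne a (Subquiver.mem_verts_of_mem_posRoots hx hi)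
      (Subquiver.mem_verts_of_mem_posRoots hy hk))

/-- Without loops in the contracted quiver, every part is a full subquiver. -/
theorem IsAdmissible.lam_arrowCompl_eq_zero (hP : P.IsAdmissible) {j : Fin ℓ} {x y : V → ℕ}
    (hx : x ∈ (P.part j).posRoots) (hy : y ∈ (P.part j).posRoots) :
    lam (arrowCompl (P.part j).arrows) x y = 0 :=
  lam_eq_zero fun _ _ hi hk =>
    ⟨Set.eq_empty_of_forall_notMem fun a ha => hP.not_contrAdj_self j (P.contrAdj_self a
      (Subquiver.mem_verts_of_mem_posRoots hx hi) (Subquiver.mem_verts_of_mem_posRoots hy hk) ha),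
    Set.eq_empty_of_forall_notMem fun a ha => hP.not_contrAdj_self j (P.contrAdj_self a
      (Subquiver.mem_verts_of_mem_posRoots hy hk) (Subquiver.mem_verts_of_mem_posRoots hx hi) ha)⟩

variable [∀ i j : V, Finite (i ⟶ j)]

theorem IsAdmissible.lam_top_eq (hP : P.IsAdmissible) {j : Fin ℓ} {x y : V → ℕ}
    (hx : x ∈ (P.part j).posRoots) (hy : y ∈ (P.part j).posRoots) :
    lam ⊤ x y = lam (P.part j).arrows x y := by
  rw [lam_top (P.part j).arrows, hP.lam_arrowCompl_eq_zero hx hy, add_zero]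

theorem IsAdmissible.orderRules_iff (hP : P.IsAdmissible) {r : ℕ} (φ : Fin r ≃ P.roots) :
    P.OrderRules φ ↔ P.SimpleOrderRules φ := by
  constructor
  · intro h a b hab j j' ha hb
    refine ⟨?_, (h a b hab j j' ha hb).2⟩
    rintro rfl
    rw [hP.lam_top_eq ha hb]
    exact ((h a b hab j j ha hb).1 rfl).1
  · intro h a b hab j j' ha hb
    refine ⟨?_, (h a b hab j j' ha hb).2⟩
    rintro rfl
    rw [hP.lam_arrowCompl_eq_zero ha hb, ← hP.lam_top_eq ha hb]
    exact ⟨(h a b hab j j ha hb).1 rfl, le_rfl⟩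

/-- An admissible partition has an ordering that satisfies the rules and runs through the parts by
increasing height, for every height on the contracted quiver. -/
theorem exists_orderRules_of_height (hQ : IsAcyclic V) (f : Fin ℓ → ℕ)
    (hinj : Function.Injective f) (hf : ∀ t h, P.ContrAdj t h → f h < f t) :
    ∃ φ : Fin (Nat.card P.roots) ≃ P.roots, P.OrderRules φ ∧
      ∀ a b, a < b → ∀ j j' : Fin ℓ, (φ a : V → ℕ) ∈ (P.part j).posRoots →
        (φ b : V → ℕ) ∈ (P.part j').posRoots → f j ≤ f j' := by
  have hP := isAdmissible_of_height f hf
  choose g hg using fun j => Subquiver.exists_posRoots_order hQ (P.isDynkin j)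
  have hmem : ∀ x : P.roots, ∃ j, (x : V → ℕ) ∈ (P.part j).posRoots :=
    fun x => Set.mem_iUnion.mp x.2
  choose p hp using hmem
  have hpu : ∀ (x : P.roots) (j : Fin ℓ), (x : V → ℕ) ∈ (P.part j).posRoots → p x = j :=
    fun x j hj => posRoots_part_unique (hp x) hj
  have := P.finite_roots.to_subtype
  -- the order within a part is the one of decreasing `g`
  obtain ⟨φ, hφ⟩ := exists_sorted_equiv
    (fun x : P.roots => (toLex (f (p x), OrderDual.toDual (g (p x) x)) : ℕ ×ₗ ℕᵒᵈ)) (by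
      intro x y hxy
      have h := toLex.injective hxy
      obtain ⟨h1, h2⟩ := Prod.mk.inj h
      have h3 := hinj h1
      have h4 := OrderDual.toDual.injective h2
      rw [← h3] at h4
      exact Subtype.ext (((hg (p x) x (hp x) y (h3 ▸ hp y)).1 h4)))
  have hlex : ∀ a b, a < b → f (p (φ a)) < f (p (φ b)) ∨ p (φ a) = p (φ b) ∧
      g (p (φ b)) (φ b) < g (p (φ a)) (φ a) := by
    intro a b hab
    rcases Prod.Lex.toLex_lt_toLex.mp (hφ a b hab) with h | ⟨h1, h2⟩
    · exact Or.inl h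
    · exact Or.inr ⟨hinj h1, h2⟩
  refine ⟨φ, (hP.orderRules_iff φ).mpr fun a b hab j j' ha hb => ?_, fun a b hab j j' ha hb => ?_⟩
  · have h := hlex a b hab
    rw [hpu _ _ ha, hpu _ _ hb] at h
    constructor
    · rintro rfl
      rcases h with h | h
      · exact absurd h (lt_irrefl _)
      · rw [hP.lam_top_eq ha hb]
        exact (hg j _ hb _ ha).2 h.2
    · intro hne
      rcases h with h | h
      · exact lam_top_nonpos hne (fun hadj => lt_asymm h (hf _ _ hadj)) ha hb
      · exact absurd h.1 hne
  · have h := hlex a b hab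
    rw [hpu _ _ ha, hpu _ _ hb] at h
    rcases h with h | h
    · exact h.le
    · rw [h.1]

theorem IsAdmissible.exists_partOrderRule (hP : P.IsAdmissible) (hQ : IsAcyclic V) (j : Fin ℓ) :
    ∃ β : Fin (Nat.card (P.part j).posRoots) ≃ (P.part j).posRoots, P.PartOrderRule j β := by
  obtain ⟨g, hg⟩ := Subquiver.exists_posRoots_order hQ (P.isDynkin j)
  have := (Subquiver.finite_posRoots (P.isDynkin j)).to_subtype
  obtain ⟨β, hβ⟩ := exists_sorted_equiv
    (fun x : (P.part j).posRoots => (OrderDual.toDual (g x) : ℕᵒᵈ)) (fun x y h =>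
      Subtype.ext ((hg x x.2 y y.2).1 (OrderDual.toDual.injective h)))
  refine ⟨β, fun a b hab => ?_⟩
  rw [hP.lam_top_eq (β a).2 (β b).2]
  exact (hg _ (β b).2 _ (β a).2).2 (hβ a b hab)

theorem finSigmaFinEquiv_lt {m : ℕ} {n : Fin m → ℕ} {j j' : Fin m} (h : j < j') (k : Fin (n j))
    (k' : Fin (n j')) :
    finSigmaFinEquiv (⟨j, k⟩ : (i : Fin m) × Fin (n i)) < finSigmaFinEquiv ⟨j', k'⟩ := by
  rw [Fin.lt_def, finSigmaFinEquiv_apply, finSigmaFinEquiv_apply]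
  let F : ℕ → ℕ := fun i => if hi : i < m then n ⟨i, hi⟩ else 0
  have hF : ∀ j : Fin m, ∑ i : Fin j, n (Fin.castLE j.2.le i) = ∑ i ∈ Finset.range j, F i := by
    intro j
    rw [← Fin.sum_univ_eq_sum_range]
    refine Finset.sum_congr rfl fun i _ => ?_
    simp only [F, dif_pos (i.2.trans j.2)]
    rfl
  simp only [hF]
  have h1 : ∑ i ∈ Finset.range (j + 1), F i ≤ ∑ i ∈ Finset.range j', F i :=
    Finset.sum_le_sum_of_subset (Finset.range_mono h)
  rw [Finset.sum_range_succ, show F j = n j from dif_pos j.2] at h1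
  have := k.2
  omega

theorem finSigmaFinEquiv_lt_cases {m : ℕ} {n : Fin m → ℕ} {j j' : Fin m} {k : Fin (n j)}
    {k' : Fin (n j')}
    (h : finSigmaFinEquiv (⟨j, k⟩ : (i : Fin m) × Fin (n i)) < finSigmaFinEquiv ⟨j', k'⟩) :
    j < j' ∨ ∃ e : j = j', e ▸ k < k' := by
  rcases lt_trichotomy j j' with hlt | rfl | hlt
  · exact Or.inl hlt
  · refine Or.inr ⟨rfl, ?_⟩
    rw [Fin.lt_def, finSigmaFinEquiv_apply, finSigmaFinEquiv_apply] at h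
    simp only [Nat.add_lt_add_iff_left] at h
    exact h
  · exact absurd h (lt_asymm (finSigmaFinEquiv_lt hlt k' k))

theorem IsOrdered.exists_isConcat (hP : P.IsOrdered) {s : Fin ℓ → ℕ}
    (β : ∀ j, Fin (s j) ≃ (P.part j).posRoots) (hβ : ∀ j, P.PartOrderRule j (β j)) :
    ∃ φ : Fin (∑ j, s j) ≃ P.roots, P.IsConcat β φ ∧ P.OrderRules φ ∧ P.SimpleOrderRules φ := by
  have hA := hP.isAdmissible
  let F : (j : Fin ℓ) × Fin (s j) → P.roots := fun q => ⟨β q.1 q.2,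
    Set.mem_iUnion.mpr ⟨q.1, (β q.1 q.2).2⟩⟩
  have hF : Function.Bijective F := by
    constructor
    · rintro ⟨j, k⟩ ⟨j', k'⟩ h
      have h' : (β j k : V → ℕ) = β j' k' := congrArg Subtype.val h
      obtain rfl : j = j' := posRoots_part_unique (β j k).2 (h' ▸ (β j' k').2)
      rw [(β j).injective (Subtype.ext h')]
    · rintro ⟨x, hx⟩
      obtain ⟨j, hj⟩ := Set.mem_iUnion.mp hx
      exact ⟨⟨j, (β j).symm ⟨x, hj⟩⟩, Subtype.ext (by simp [F])⟩
  let φ : Fin (∑ j, s j) ≃ P.roots := finSigmaFinEquiv.symm.trans (Equiv.ofBijective F hF)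
  have hφ : ∀ j k, (φ (finSigmaFinEquiv ⟨j, k⟩) : V → ℕ) = β j k := by
    intro j k
    simp only [φ, Equiv.trans_apply, Equiv.symm_apply_apply, Equiv.ofBijective_apply, F]
  have hsimple : P.SimpleOrderRules φ := by
    intro a b hab i i' ha hb
    obtain ⟨⟨j, k⟩, rfl⟩ := finSigmaFinEquiv.surjective a
    obtain ⟨⟨j', k'⟩, rfl⟩ := finSigmaFinEquiv.surjective b
    rw [hφ] at ha hb ⊢
    rw [hφ]
    obtain rfl := posRoots_part_unique (β j k).2 ha
    obtain rfl := posRoots_part_unique (β j' k').2 hb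
    rcases finSigmaFinEquiv_lt_cases hab with h | ⟨rfl, h⟩
    · exact ⟨fun e => absurd e h.ne, fun hne =>
        lam_top_nonpos hne (fun hadj => lt_asymm h (hP _ _ hadj)) ha hb⟩
    · exact ⟨fun _ => hβ j k k' h, fun hne => absurd rfl hne⟩
  exact ⟨φ, hφ, (hA.orderRules_iff φ).mpr hsimple, hsimple⟩

end DynkinPartition

/-! ### Roots with coordinates zero and one -/

/-- The indicator vector of a finite set. -/
def indVec {V : Type u} [DecidableEq V] (s : Finset V) : V → ℕ := fun i => if i ∈ s then 1 else 0

theorem indVec_ne_zero_iff {V : Type u} [DecidableEq V] {s : Finset V} {i : V} :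
    indVec s i ≠ 0 ↔ i ∈ s := by
  simp [indVec]

namespace Subquiver

section Indicator

variable {V : Type u} [Fintype V] [DecidableEq V] [Quiver.{v} V] {S : Subquiver V}

theorem form_indVec (s t : Finset V) : Matrix.toBilin' S.cartanMatrix (intVec (indVec s))
    (intVec (indVec t)) = ∑ i ∈ s, ∑ j ∈ t, S.cartan i j := by
  rw [Matrix.toBilin'_apply]
  simp [intVec, indVec, cartanMatrix_apply, Finset.sum_ite_mem]

theorem neg_one_le_form_of_mem_posRoots (hS : S.IsDynkin) {x y : V → ℕ} (hx : x ∈ S.posRoots)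
    (hy : y ∈ S.posRoots) : -1 ≤ Matrix.toBilin' S.cartanMatrix (intVec x) (intVec y) := by
  have h := hS.isPosCartan.form_add_self (intVec x) (intVec y)
  rw [form_self_of_mem_posRoots hS hx, form_self_of_mem_posRoots hS hy] at h
  have hne : intVec x + intVec y ≠ 0 := by
    intro h0
    obtain ⟨k, hk⟩ := exists_ne_zero_of_mem_posRoots hS hx
    have : (x k : ℤ) + y k = 0 := congrFun h0 k
    omega
  have := hS.isPosCartan.pos _ hne
  omega

/-- A root with coordinates zero and one can be enlarged by any vertex adjacent to its support:
by positivity the vertex is adjacent to only one vertex of the support. -/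
theorem indVec_insert_mem_posRoots (hS : S.IsDynkin) {s : Finset V} (hs : indVec s ∈ S.posRoots)
    {i k : V} (hi : i ∉ s) (hk : k ∈ s) (hik : S.cartan i k < 0) :
    indVec (insert i s) ∈ S.posRoots := by
  have hiS : i ∈ S.verts := mem_verts_of_cartan_neg hik
  have hsum : ∑ j, S.cartan i j * (indVec s j : ℤ) = -1 := by
    have h1 : ∑ j, S.cartan i j * (indVec s j : ℤ) = ∑ j ∈ s, S.cartan i j := by
      simp [indVec, Finset.sum_ite_mem]
    have h2 : ∑ j ∈ s, S.cartan i j < 0 := Finset.sum_neg'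
      (fun j hj => S.cartan_nonpos (by rintro rfl; exact hi hj)) ⟨k, hk, hik⟩
    have h3 := neg_one_le_form_of_mem_posRoots hS (single_mem_posRoots hiS) hs
    have h4 : (Pi.single i 1 : V → ℕ) = indVec {i} := by
      ext j
      simp [indVec, Pi.single_apply]
    rw [h4, form_indVec, Finset.sum_singleton] at h3
    omega
  have h := IsRoot.reflect i hiS _ hs
  rw [hsum] at h
  change S.IsRoot _
  convert h using 1
  ext j
  by_cases hj : j = i
  · subst hj; simp [indVec, hi]
  · simp [indVec, hj]

theorem indVec_singleton_mem_posRoots {i : V} (hi : i ∈ S.verts) : indVec {i} ∈ S.posRoots := by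
  convert single_mem_posRoots hi using 1
  ext j
  simp [indVec, Pi.single_apply]

/-- A Dynkin subquiver has a root whose support is the whole subquiver. -/
theorem exists_indVec_verts_mem_posRoots (hS : S.IsDynkin) :
    ∃ s : Finset V, (∀ i, i ∈ s ↔ i ∈ S.verts) ∧ indVec s ∈ S.posRoots := by
  obtain ⟨i₀, hi₀⟩ := hS.nonempty
  obtain ⟨s, ⟨⟨hs₀, hs⟩, hmax⟩⟩ := (Set.toFinite
    {s : Finset V | s.Nonempty ∧ indVec s ∈ S.posRoots}).exists_maximal
    ⟨{i₀}, Finset.singleton_nonempty i₀, indVec_singleton_mem_posRoots hi₀⟩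
  have hsub : ∀ i, i ∈ s → i ∈ S.verts := fun i hi =>
    mem_verts_of_mem_posRoots hs (indVec_ne_zero_iff.mpr hi)
  refine ⟨s, fun k => ⟨hsub k, fun hk => ?_⟩, hs⟩
  obtain ⟨i, hi⟩ := hs₀
  induction hS.connected (hsub i hi) hk with
  | refl => exact hi
  | @tail a b _ hab ih =>
    have ha := ih (mem_verts_of_cartan_neg hab)
    by_contra hb
    rw [cartan_comm] at hab
    exact hb (hmax ⟨Finset.insert_nonempty b s, indVec_insert_mem_posRoots hS hs hb ha hab⟩
      (Finset.subset_insert b s) (Finset.mem_insert_self b s))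

/-- Between the supports of two disjoint roots with coordinates zero and one there is at most one
arrow of the subquiver. -/
theorem arrows_eq_empty_of_disjoint (hS : S.IsDynkin) {s t : Finset V} (hst : Disjoint s t)
    (hs : indVec s ∈ S.posRoots) (ht : indVec t ∈ S.posRoots) {i₀ k₀ : V} (hi₀ : i₀ ∈ s)
    (hk₀ : k₀ ∈ t) [∀ i j : V, Finite (i ⟶ j)] (ha : (S.arrows k₀ i₀).Nonempty) {i k : V}
    (hi : i ∈ s) (hk : k ∈ t) : S.arrows i k = ∅ := by
  by_contra hne
  have ha' := Set.nonempty_iff_ne_empty.mpr hne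
  have hpos₀ : 0 < (S.arrows k₀ i₀).ncard := (Set.ncard_pos (Set.toFinite _)).mpr ha
  have hpos : 0 < (S.arrows i k).ncard := (Set.ncard_pos (Set.toFinite _)).mpr ha'
  have hne' : ∀ p ∈ s ×ˢ t, p.1 ≠ p.2 := by
    intro p hp h
    rw [Finset.mem_product] at hp
    exact Finset.disjoint_left.mp hst hp.1 (h ▸ hp.2)
  have hform := neg_one_le_form_of_mem_posRoots hS hs ht
  rw [form_indVec, ← Finset.sum_product' (f := fun i j => S.cartan i j)] at hform
  have hmem₀ : (i₀, k₀) ∈ s ×ˢ t := Finset.mem_product.mpr ⟨hi₀, hk₀⟩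
  have hmem : (i, k) ∈ s ×ˢ t := Finset.mem_product.mpr ⟨hi, hk⟩
  have hle : ∀ u ⊆ s ×ˢ t, ∑ p ∈ s ×ˢ t, S.cartan p.1 p.2 ≤ ∑ p ∈ u, S.cartan p.1 p.2 := by
    intro u hu
    exact Finset.sum_le_sum_of_subset_of_nonpos' hu fun p hp _ => S.cartan_nonpos (hne' p hp)
  by_cases heq : (i, k) = (i₀, k₀)
  · obtain ⟨rfl, rfl⟩ := Prod.mk.inj heq
    have h := hle {(i, k)} (Finset.singleton_subset_iff.mpr hmem)
    rw [Finset.sum_singleton, cartan, if_neg (hne' _ hmem)] at h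
    dsimp only at h
    omega
  · have h := hle {(i, k), (i₀, k₀)} (Finset.insert_subset hmem
      (Finset.singleton_subset_iff.mpr hmem₀))
    rw [Finset.sum_pair heq, cartan, cartan, if_neg (hne' _ hmem), if_neg (hne' _ hmem₀)] at h
    dsimp only at h
    omega

end Indicator

end Subquiver

/-! ### Geodesics in a Dynkin subquiver -/

namespace Subquiver

section Geodesic

variable {V : Type u} [DecidableEq V] [Quiver.{v} V]

/-- The simple graph underlying a subquiver. -/
def graph (S : Subquiver V) : SimpleGraph V where
  Adj i k := i ≠ k ∧ S.cartan i k < 0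
  symm := ⟨fun _ _ h => ⟨h.1.symm, by rw [cartan_comm]; exact h.2⟩⟩
  loopless := ⟨fun _ h => h.1 rfl⟩

/-- The vertices `c 0, …, c r` form a geodesic of the graph underlying a subquiver. -/
structure IsGeodesic (S : Subquiver V) (c : ℕ → V) (r : ℕ) : Prop where
  mem : ∀ a ≤ r, c a ∈ S.verts
  adj : ∀ a < r, S.cartan (c a) (c (a + 1)) < 0
  injOn : Set.InjOn c {a | a ≤ r}
  dist_le : ∀ a b, a ≤ b → b ≤ r → S.graph.dist (c a) (c b) ≤ b - a

theorem IsDynkin.exists_isGeodesic {S : Subquiver V} (hS : S.IsDynkin) {i k : V}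
    (hi : i ∈ S.verts) (hk : k ∈ S.verts) :
    ∃ c : ℕ → V, c 0 = i ∧ c (S.graph.dist i k) = k ∧ S.IsGeodesic c (S.graph.dist i k) := by
  have hreach : S.graph.Reachable i k := by
    induction hS.connected hi hk with
    | refl => exact SimpleGraph.Reachable.refl _
    | @tail a b _ hab ih =>
      have h := ih (mem_verts_of_cartan_neg hab)
      by_cases he : a = b
      · rw [← he]; exact h
      · exact h.trans (SimpleGraph.Adj.reachable (show S.graph.Adj a b from ⟨he, hab⟩))
  obtain ⟨p, hp⟩ := hreach.exists_walk_length_eq_dist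
  have hpath := p.isPath_of_length_eq_dist hp
  have hadj : ∀ a < p.length, S.graph.Adj (p.getVert a) (p.getVert (a + 1)) :=
    fun a ha => p.adj_getVert_succ ha
  rw [← hp]
  refine ⟨p.getVert, p.getVert_zero, p.getVert_length, fun a ha => ?_, fun a ha => (hadj a ha).2,
    hpath.getVert_injOn, fun a b hab hb => ?_⟩
  · rcases a with _ | a
    · rw [p.getVert_zero]; exact hi
    · have := (hadj a ha).symm.2
      exact mem_verts_of_cartan_neg this
  · obtain ⟨m, rfl⟩ := Nat.exists_eq_add_of_le hab
    have hwalk : ∀ m, a + m ≤ p.length →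
        ∃ q : S.graph.Walk (p.getVert a) (p.getVert (a + m)), q.length = m := by
      intro m
      induction m with
      | zero => exact fun _ => ⟨SimpleGraph.Walk.nil, rfl⟩
      | succ m ih =>
        intro hm
        obtain ⟨q, hq⟩ := ih (by omega)
        exact ⟨q.concat (hadj (a + m) (by omega)), by rw [SimpleGraph.Walk.length_concat, hq]⟩
    obtain ⟨q, hq⟩ := hwalk m hb
    rw [Nat.add_sub_cancel_left]
    exact (SimpleGraph.dist_le q).trans hq.le

/-- The set of the vertices `c a, …, c b`. -/
def segment {V : Type u} [DecidableEq V] (c : ℕ → V) (a b : ℕ) : Finset V :=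
  (Finset.Icc a b).image c

theorem mem_segment {V : Type u} [DecidableEq V] {c : ℕ → V} {a b : ℕ} {i : V} :
    i ∈ segment c a b ↔ ∃ k, a ≤ k ∧ k ≤ b ∧ c k = i := by
  simp [segment, and_assoc]

variable [Fintype V] {S : Subquiver V}

theorem IsGeodesic.indVec_segment_mem_posRoots (hS : S.IsDynkin) {c : ℕ → V} {r : ℕ}
    (hc : S.IsGeodesic c r) {a b : ℕ} (hab : a ≤ b) (hb : b ≤ r) :
    indVec (segment c a b) ∈ S.posRoots := by
  induction b, hab using Nat.le_induction with
  | base =>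
    rw [segment, Finset.Icc_self, Finset.image_singleton]
    exact indVec_singleton_mem_posRoots (hc.mem a hb)
  | succ b hab ih =>
    have : segment c a (b + 1) = insert (c (b + 1)) (segment c a b) := by
      rw [segment, ← Finset.insert_Icc_right_eq_Icc_add_one (by omega), Finset.image_insert]
      rfl
    rw [this]
    refine indVec_insert_mem_posRoots hS (ih (by omega)) (fun hmem => ?_)
      (mem_segment.mpr ⟨b, hab, le_rfl, rfl⟩) (by rw [cartan_comm]; exact hc.adj b (by omega))
    obtain ⟨k, _, hk2, hk3⟩ := mem_segment.mp hmem
    have := hc.injOn (show k ≤ r by omega) (show b + 1 ≤ r from hb) hk3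
    omega

end Geodesic

end Subquiver

/-! ### Orderings force admissibility -/

namespace DynkinPartition

variable {V : Type u} [Fintype V] [DecidableEq V] [Quiver.{v} V] {ℓ : ℕ}

/-- A numbering of the roots that satisfies the ordering rules, in the form in which a strict sign
of the antisymmetrized Euler form decides the order. -/
structure IsRank (P : DynkinPartition V ℓ) (ρ : (V → ℕ) → ℕ) : Prop where
  inner : ∀ {j x y}, x ∈ (P.part j).posRoots → y ∈ (P.part j).posRoots →
    lam (P.part j).arrows x y < 0 → ρ y < ρ x
  outer : ∀ {j x y}, x ∈ (P.part j).posRoots → y ∈ (P.part j).posRoots →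
    lam (arrowCompl (P.part j).arrows) x y < 0 → ρ x < ρ y
  cross : ∀ {j j' x y}, j ≠ j' → x ∈ (P.part j).posRoots → y ∈ (P.part j').posRoots →
    lam ⊤ x y < 0 → ρ x < ρ y

variable {P : DynkinPartition V ℓ}

theorem OrderRules.exists_isRank {r : ℕ} {φ : Fin r ≃ P.roots} (h : P.OrderRules φ) :
    ∃ ρ, P.IsRank ρ := by
  classical
  let ρ : (V → ℕ) → ℕ := fun x => if hx : x ∈ P.roots then φ.symm ⟨x, hx⟩ else 0
  have hmem : ∀ {j x}, x ∈ (P.part j).posRoots → x ∈ P.roots :=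
    fun {j x} hx => Set.mem_iUnion.mpr ⟨j, hx⟩
  have hρ : ∀ {x y} (hx : x ∈ P.roots) (hy : y ∈ P.roots) (j j' : Fin ℓ),
      x ∈ (P.part j).posRoots → y ∈ (P.part j').posRoots → ρ x < ρ y →
      (j = j' → 0 ≤ lam (P.part j).arrows x y ∧
        lam (arrowCompl (P.part j).arrows) x y ≤ 0) ∧ (j ≠ j' → lam ⊤ x y ≤ 0) := by
    intro x y hx hy j j' hxj hyj hlt
    simp only [ρ, dif_pos hx, dif_pos hy] at hlt
    have := h (φ.symm ⟨x, hx⟩) (φ.symm ⟨y, hy⟩) hlt j j'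
    simp only [Equiv.apply_symm_apply] at this
    exact this hxj hyj
  have hinj : ∀ {x y} (hx : x ∈ P.roots) (hy : y ∈ P.roots), ρ x = ρ y → x = y := by
    intro x y hx hy hxy
    simp only [ρ, dif_pos hx, dif_pos hy] at hxy
    exact congrArg Subtype.val (φ.symm.injective (Fin.ext hxy))
  have hself : ∀ (A : WideSubquiver V) x, lam A x x = 0 := fun A x => sub_self _
  refine ⟨ρ, fun {j x y} hx hy hlam => ?_, fun {j x y} hx hy hlam => ?_,
    fun {j j' x y} hne hx hy hlam => ?_⟩
  · rcases lt_trichotomy (ρ x) (ρ y) with hlt | heq | hlt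
    · have := ((hρ (hmem hx) (hmem hy) j j hx hy hlt).1 rfl).1
      omega
    · rw [hinj (hmem hx) (hmem hy) heq, hself] at hlam
      exact absurd hlam (lt_irrefl _)
    · exact hlt
  · rcases lt_trichotomy (ρ x) (ρ y) with hlt | heq | hlt
    · exact hlt
    · rw [hinj (hmem hx) (hmem hy) heq, hself] at hlam
      exact absurd hlam (lt_irrefl _)
    · have := ((hρ (hmem hy) (hmem hx) j j hy hx hlt).1 rfl).2
      rw [lam_antisymm] at this
      omega
  · rcases lt_trichotomy (ρ x) (ρ y) with hlt | heq | hlt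
    · exact hlt
    · rw [hinj (hmem hx) (hmem hy) heq, hself] at hlam
      exact absurd hlam (lt_irrefl _)
    · have := (hρ (hmem hy) (hmem hx) j' j hy hx hlt).2 hne.symm
      rw [lam_antisymm] at this
      omega

variable [∀ i j : V, Finite (i ⟶ j)]

namespace IsRank

variable {ρ : (V → ℕ) → ℕ} (hρ : P.IsRank ρ)
include hρ

/-- If, wherever a geodesic is cut in two, its initial segment precedes its final segment, then the
geodesic is an oriented path: an edge pointing backwards would reverse the order of the two
segments. -/
theorem nonempty_path {j : Fin ℓ} {c : ℕ → V} {r : ℕ} (hc : (P.part j).IsGeodesic c r)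
    (hcut : ∀ a < r, ρ (indVec (Subquiver.segment c 0 a)) <
      ρ (indVec (Subquiver.segment c (a + 1) r))) :
    Nonempty (Quiver.Path (c 0) (c r)) := by
  have hS := P.isDynkin j
  have harrow : ∀ a < r, Nonempty (c a ⟶ c (a + 1)) := by
    intro a ha
    by_contra hnone
    have hempty : (P.part j).arrows (c a) (c (a + 1)) = ∅ :=
      Set.eq_empty_of_forall_notMem fun x _ => hnone ⟨x⟩
    have hback : ((P.part j).arrows (c (a + 1)) (c a)).Nonempty := by
      rw [Set.nonempty_iff_ne_empty]
      intro hempty'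
      have := hc.adj a ha
      rw [Subquiver.cartan, hempty, hempty', Set.ncard_empty, Set.ncard_empty] at this
      split_ifs at this <;> omega
    have h1 := hc.indVec_segment_mem_posRoots hS (Nat.zero_le a) ha.le
    have h2 := hc.indVec_segment_mem_posRoots hS (Nat.succ_le_of_lt ha) le_rfl
    have hdisj : Disjoint (Subquiver.segment c 0 a) (Subquiver.segment c (a + 1) r) := by
      rw [Finset.disjoint_left]
      intro i hi hi'
      obtain ⟨k, _, hk2, rfl⟩ := Subquiver.mem_segment.mp hi
      obtain ⟨m, hm1, hm2, hmk⟩ := Subquiver.mem_segment.mp hi'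
      have := hc.injOn (show m ≤ r from hm2) (show k ≤ r by omega) hmk
      omega
    have m1 : c a ∈ Subquiver.segment c 0 a :=
      Subquiver.mem_segment.mpr ⟨a, Nat.zero_le _, le_rfl, rfl⟩
    have m2 : c (a + 1) ∈ Subquiver.segment c (a + 1) r :=
      Subquiver.mem_segment.mpr ⟨a + 1, le_rfl, ha, rfl⟩
    refine lt_asymm (hcut a ha) (hρ.inner h1 h2 (lam_neg (fun i k hi hk => ?_)
      (indVec_ne_zero_iff.mpr m1) (indVec_ne_zero_iff.mpr m2) hback))
    exact Subquiver.arrows_eq_empty_of_disjoint hS hdisj h1 h2 m1 m2 hback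
      (indVec_ne_zero_iff.mp hi) (indVec_ne_zero_iff.mp hk)
  have hpath : ∀ a ≤ r, Nonempty (Quiver.Path (c 0) (c a)) := by
    intro a
    induction a with
    | zero => exact fun _ => ⟨Quiver.Path.nil⟩
    | succ a ih =>
      intro ha
      obtain ⟨p⟩ := ih (by omega)
      obtain ⟨x⟩ := harrow a ha
      exact ⟨p.cons x⟩
  exact hpath r le_rfl

/-- The contracted quiver has no loops. For a loop from `t` to `h` in a part at minimal distance,
the initial segments of the geodesic from `h` to `t` precede the final ones, so the geodesic and the
loop form an oriented cycle. -/
theorem not_contrAdj_self (hQ : IsAcyclic V) (j : Fin ℓ) : ¬ P.ContrAdj j j := by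
  intro hadj
  have hS := P.isDynkin j
  let D : Set ℕ := {d | ∃ (t h : V) (x : t ⟶ h), t ∈ (P.part j).verts ∧ h ∈ (P.part j).verts ∧
    x ∉ (P.part j).arrows t h ∧ (P.part j).graph.dist h t = d}
  have hD : D.Nonempty := by
    obtain ⟨t, h, x, ht, hh, hx⟩ := P.contrAdj_iff.mp hadj
    exact ⟨_, t, h, x, ht, hh, hx j, rfl⟩
  obtain ⟨t, h, x, ht, hh, hx, hdist⟩ := Nat.sInf_mem hD
  have hmin : ∀ {t' h' : V} (x' : t' ⟶ h'), t' ∈ (P.part j).verts → h' ∈ (P.part j).verts →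
      x' ∉ (P.part j).arrows t' h' →
      (P.part j).graph.dist h t ≤ (P.part j).graph.dist h' t' := by
    intro t' h' x' h1 h2 h3
    rw [hdist]
    exact Nat.sInf_le ⟨t', h', x', h1, h2, h3, rfl⟩
  obtain ⟨c, hc0, hcr, hc⟩ := hS.exists_isGeodesic hh ht
  set r := (P.part j).graph.dist h t with hr
  have hpath := hρ.nonempty_path hc fun a ha => by
    refine hρ.outer (hc.indVec_segment_mem_posRoots hS (Nat.zero_le a) ha.le)
      (hc.indVec_segment_mem_posRoots hS (Nat.succ_le_of_lt ha) le_rfl)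
      (lam_neg (i₀ := h) (j₀ := t) (fun i k hi hk => ?_)
        (indVec_ne_zero_iff.mpr (Subquiver.mem_segment.mpr ⟨0, le_rfl, Nat.zero_le _, hc0⟩))
        (indVec_ne_zero_iff.mpr (Subquiver.mem_segment.mpr ⟨r, ha, le_rfl, hcr⟩)) ⟨x, hx⟩)
    obtain ⟨p, _, hp, rfl⟩ := Subquiver.mem_segment.mp (indVec_ne_zero_iff.mp hi)
    obtain ⟨q, hq, hqr, rfl⟩ := Subquiver.mem_segment.mp (indVec_ne_zero_iff.mp hk)
    refine Set.eq_empty_of_forall_notMem fun y hy => ?_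
    have h1 := hmin y (hc.mem p (by omega)) (hc.mem q hqr) hy
    rw [SimpleGraph.dist_comm] at h1
    have h2 := hc.dist_le p q (by omega) hqr
    -- a parallel arrow in the opposite direction would close an oriented cycle of length two
    have hp0 : p = 0 := by omega
    have hqr' : q = r := by omega
    subst hp0
    rw [hc0, hqr', hcr] at y
    exact Nat.succ_ne_zero _ (hQ h ((Quiver.Path.nil.cons y).cons x))
  obtain ⟨p⟩ := hpath
  rw [hc0, hcr] at p
  exact Nat.succ_ne_zero _ (hQ h (p.cons x))

/-- Half of the argument against cycles of length two of the contracted quiver: `c` and `d` are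
geodesics in different parts such that, between them, all arrows from `c` to `d` start at the end of
`c` and all arrows from `d` to `c` end at the start of `c`, and both kinds exist. -/
theorem nonempty_path_of_cross {j j' : Fin ℓ} (hne : j ≠ j') {c d : ℕ → V} {r s : ℕ}
    (hc : (P.part j).IsGeodesic c r) (hd : (P.part j').IsGeodesic d s)
    (x : c r ⟶ d 0) (y : d s ⟶ c 0)
    (hx : ∀ a b, a ≤ r → b ≤ s → Nonempty (c a ⟶ d b) → a = r)
    (hy : ∀ a b, a ≤ r → b ≤ s → Nonempty (d b ⟶ c a) → a = 0) :
    Nonempty (Quiver.Path (c 0) (c r)) := by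
  have hd' := hd.indVec_segment_mem_posRoots (P.isDynkin j') (Nat.zero_le s) le_rfl
  refine hρ.nonempty_path hc fun a ha => ?_
  -- the root of the whole geodesic `d` separates the two segments of `c`
  have h1 : ρ (indVec (Subquiver.segment c 0 a)) < ρ (indVec (Subquiver.segment d 0 s)) := by
    refine hρ.cross hne (hc.indVec_segment_mem_posRoots (P.isDynkin j) (Nat.zero_le a) ha.le) hd'
      (lam_neg (i₀ := c 0) (j₀ := d s) (fun i k hi hk => ?_)
        (indVec_ne_zero_iff.mpr (Subquiver.mem_segment.mpr ⟨0, le_rfl, Nat.zero_le _, rfl⟩))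
        (indVec_ne_zero_iff.mpr (Subquiver.mem_segment.mpr ⟨s, Nat.zero_le _, le_rfl, rfl⟩))
        ⟨y, trivial⟩)
    obtain ⟨p, _, hp, rfl⟩ := Subquiver.mem_segment.mp (indVec_ne_zero_iff.mp hi)
    obtain ⟨q, _, hq, rfl⟩ := Subquiver.mem_segment.mp (indVec_ne_zero_iff.mp hk)
    refine Set.eq_empty_of_forall_notMem fun z _ => ?_
    have := hx p q (by omega) hq ⟨z⟩
    omega
  have h2 : ρ (indVec (Subquiver.segment d 0 s)) < ρ (indVec (Subquiver.segment c (a + 1) r)) := by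
    refine hρ.cross hne.symm hd'
      (hc.indVec_segment_mem_posRoots (P.isDynkin j) (Nat.succ_le_of_lt ha) le_rfl)
      (lam_neg (i₀ := d 0) (j₀ := c r) (fun k i hk hi => ?_)
        (indVec_ne_zero_iff.mpr (Subquiver.mem_segment.mpr ⟨0, le_rfl, Nat.zero_le _, rfl⟩))
        (indVec_ne_zero_iff.mpr (Subquiver.mem_segment.mpr ⟨r, ha, le_rfl, rfl⟩))
        ⟨x, trivial⟩)
    obtain ⟨p, hp, hpr, rfl⟩ := Subquiver.mem_segment.mp (indVec_ne_zero_iff.mp hi)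
    obtain ⟨q, _, hq, rfl⟩ := Subquiver.mem_segment.mp (indVec_ne_zero_iff.mp hk)
    refine Set.eq_empty_of_forall_notMem fun z _ => ?_
    have := hy p q hpr hq ⟨z⟩
    omega
  exact h1.trans h2

/-- The contracted quiver has no cycles of length two. For two such arrows between different parts
whose ends are at minimal total distance, both geodesics are oriented paths, and the arrows close
them to an oriented cycle. -/
theorem not_contrAdj_symm (hQ : IsAcyclic V) {j j' : Fin ℓ} (hne : j ≠ j') (h1 : P.ContrAdj j j') :
    ¬ P.ContrAdj j' j := by
  intro h2
  have hS := P.isDynkin j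
  have hS' := P.isDynkin j'
  let D : Set ℕ := {m | ∃ (t h t' h' : V) (_ : t ⟶ h') (_ : t' ⟶ h),
    t ∈ (P.part j).verts ∧ h ∈ (P.part j).verts ∧ t' ∈ (P.part j').verts ∧
    h' ∈ (P.part j').verts ∧
    (P.part j).graph.dist h t + (P.part j').graph.dist h' t' = m}
  have hD : D.Nonempty := by
    obtain ⟨t, h', x, ht, hh', -⟩ := P.contrAdj_iff.mp h1
    obtain ⟨t', h, y, ht', hh, -⟩ := P.contrAdj_iff.mp h2
    exact ⟨_, t, h, t', h', x, y, ht, hh, ht', hh', rfl⟩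
  obtain ⟨t, h, t', h', x, y, ht, hh, ht', hh', hdist⟩ := Nat.sInf_mem hD
  have hmin : ∀ {t₁ h₁ t₂ h₂ : V} (_ : t₁ ⟶ h₂) (_ : t₂ ⟶ h₁), t₁ ∈ (P.part j).verts →
      h₁ ∈ (P.part j).verts → t₂ ∈ (P.part j').verts → h₂ ∈ (P.part j').verts →
      (P.part j).graph.dist h t + (P.part j').graph.dist h' t' ≤
        (P.part j).graph.dist h₁ t₁ + (P.part j').graph.dist h₂ t₂ := by
    intro t₁ h₁ t₂ h₂ x' y' e1 e2 e3 e4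
    rw [hdist]
    exact Nat.sInf_le ⟨t₁, h₁, t₂, h₂, x', y', e1, e2, e3, e4, rfl⟩
  obtain ⟨c, hc0, hcr, hc⟩ := hS.exists_isGeodesic hh ht
  obtain ⟨d, hd0, hds, hd⟩ := hS'.exists_isGeodesic hh' ht'
  set r := (P.part j).graph.dist h t
  set s := (P.part j').graph.dist h' t'
  have hx : ∀ a b, a ≤ r → b ≤ s → Nonempty (c a ⟶ d b) → a = r ∧ b = 0 := by
    rintro a b ha hb ⟨z⟩
    have e1 := hmin z y (hc.mem a ha) hh ht' (hd.mem b hb)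
    have e2 := hc.dist_le 0 a (Nat.zero_le _) ha
    have e3 := hd.dist_le b s hb le_rfl
    rw [hc0] at e2
    rw [hds] at e3
    omega
  have hy : ∀ a b, a ≤ r → b ≤ s → Nonempty (d b ⟶ c a) → a = 0 ∧ b = s := by
    rintro a b ha hb ⟨z⟩
    have e1 := hmin x z ht (hc.mem a ha) (hd.mem b hb) hh'
    have e2 := hc.dist_le a r ha le_rfl
    have e3 := hd.dist_le 0 b (Nat.zero_le _) hb
    rw [hcr] at e2
    rw [hd0] at e3
    omega
  rw [← hcr, ← hd0] at x
  rw [← hc0, ← hds] at y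
  obtain ⟨p⟩ := hρ.nonempty_path_of_cross hne hc hd x y (fun a b ha hb z => (hx a b ha hb z).1)
    fun a b ha hb z => (hy a b ha hb z).1
  obtain ⟨q⟩ := hρ.nonempty_path_of_cross hne.symm hd hc y x
    (fun b a hb ha z => (hy a b ha hb z).2) fun b a hb ha z => (hx a b ha hb z).2
  exact Nat.succ_ne_zero _ (hQ (c 0) (((p.cons x).comp q).cons y))

/-- Once loops and cycles of length two are excluded, the ranks of roots with full support decrease
along the arrows of the contracted quiver. -/
theorem isAdmissible (hQ : IsAcyclic V) : P.IsAdmissible := by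
  choose s hs hroot using fun j => Subquiver.exists_indVec_verts_mem_posRoots (P.isDynkin j)
  refine isAdmissible_of_height (fun j => ρ (indVec (s j))) fun t h hadj => ?_
  have hne : t ≠ h := by
    rintro rfl
    exact hρ.not_contrAdj_self hQ t hadj
  have hnot := hρ.not_contrAdj_symm hQ hne hadj
  obtain ⟨i, k, a, hi, hk, -⟩ := P.contrAdj_iff.mp hadj
  refine hρ.cross hne.symm (hroot h) (hroot t)
    (lam_neg (i₀ := k) (j₀ := i) (fun k' i' hk' hi' => ?_)
    (indVec_ne_zero_iff.mpr ((hs h k).mpr hk)) (indVec_ne_zero_iff.mpr ((hs t i).mpr hi))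
    ⟨a, trivial⟩)
  exact Set.eq_empty_of_forall_notMem fun z _ => hnot (P.contrAdj_of_ne hne.symm z
    ((hs h k').mp (indVec_ne_zero_iff.mp hk')) ((hs t i').mp (indVec_ne_zero_iff.mp hi')))

end IsRank

theorem isAdmissible_of_orderRules (hQ : IsAcyclic V) {r : ℕ} {φ : Fin r ≃ P.roots}
    (h : P.OrderRules φ) : P.IsAdmissible := by
  obtain ⟨ρ, hρ⟩ := h.exists_isRank
  exact hρ.isAdmissible hQ

end DynkinPartition

/-! ### A quiver with two orderings -/

/-- The subquiver with one vertex and no arrows. -/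
def vertexSubquiver {V : Type u} [Quiver.{v} V] (i : V) : Subquiver V where
  verts := {i}
  arrows _ _ := ∅
  tail_mem h := h.elim
  head_mem h := h.elim

theorem isDynkin_vertexSubquiver {V : Type u} [DecidableEq V] [Quiver.{v} V] (i : V) :
    (vertexSubquiver i).IsDynkin := by
  let _ : Unique (vertexSubquiver i).verts := Set.uniqueSingleton i
  refine Or.inl ⟨1, le_rfl, Equiv.ofUnique _ _, fun a b => ?_⟩
  rw [Subsingleton.elim (Equiv.ofUnique (Fin 1) (vertexSubquiver i).verts a)
    (Equiv.ofUnique (Fin 1) (vertexSubquiver i).verts b), Subsingleton.elim a b]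
  simp [Subquiver.cartan, vertexSubquiver, CartanMatrix.A]

/-- The partition of a quiver into its vertices, numbered by `e`. -/
def vertexPartition {V : Type u} [DecidableEq V] [Quiver.{v} V] {ℓ : ℕ} (e : Fin ℓ ≃ V) :
    DynkinPartition V ℓ where
  part j := vertexSubquiver (e j)
  isDynkin j := isDynkin_vertexSubquiver (e j)
  disjoint _ _ h := Set.disjoint_singleton.mpr (e.injective.ne h)
  cover i := ⟨e.symm i, (e.apply_symm_apply i).symm⟩

/-- The vertices of the quiver `• ⟶ • ⟵ •`: the sink is `none`. -/
def Cospan : Type := Option Bool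

instance : Fintype Cospan := inferInstanceAs (Fintype (Option Bool))

instance : DecidableEq Cospan := inferInstanceAs (DecidableEq (Option Bool))

instance : Quiver.{0} Cospan where
  Hom i j := {_x : Unit // i ≠ (none : Option Bool) ∧ j = (none : Option Bool)}

instance (i j : Cospan) : Finite (i ⟶ j) :=
  inferInstanceAs (Finite {_x : Unit // i ≠ (none : Option Bool) ∧ j = (none : Option Bool)})

/-- A height on the cospan; the flag `b` decides which of the two sources is the higher one. -/
def cospanHeight (b : Bool) : Cospan → ℕ
  | none => 0
  | some c => if b = c then 2 else 1

theorem cospanHeight_injective (b : Bool) : Function.Injective (cospanHeight b) := by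
  rintro (_ | c) (_ | d) h
  · rfl
  · simp only [cospanHeight] at h
    split_ifs at h
  · simp only [cospanHeight] at h
    split_ifs at h
  · have hcd : ∀ b c d : Bool, ((if b = c then 2 else 1) = if b = d then 2 else 1) → c = d := by
      decide
    rw [hcd b c d h]

theorem cospanHeight_lt (b : Bool) (i j : Cospan) (h : Nonempty (i ⟶ j)) :
    cospanHeight b j < cospanHeight b i := by
  obtain ⟨⟨_, hi, rfl⟩⟩ := h
  rcases i with _ | c
  · exact absurd rfl hi
  · simp only [cospanHeight]
    split_ifs <;> omega

theorem isAcyclic_cospan : IsAcyclic Cospan :=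
  isAcyclic_of_height (cospanHeight true) (cospanHeight_lt true)

/-- The partition of the cospan into its vertices has two orderings: the sink comes first, and the
two sources can be taken in either order. -/
theorem exists_two_orderRules : ∃ (m : ℕ) (R : DynkinPartition Cospan m) (r : ℕ)
    (φ ψ : Fin r ≃ R.roots), R.IsAdmissible ∧ φ ≠ ψ ∧ R.OrderRules φ ∧ R.OrderRules ψ := by
  let e : Fin (Fintype.card Cospan) ≃ Cospan := (Fintype.equivFin Cospan).symm
  let R := vertexPartition e
  have hlt : ∀ b t h, R.ContrAdj t h → cospanHeight b (e h) < cospanHeight b (e t) := by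
    intro b t h hadj
    obtain ⟨i, k, a, hi, hk, -⟩ := R.contrAdj_iff.mp hadj
    obtain rfl : i = e t := hi
    obtain rfl : k = e h := hk
    exact cospanHeight_lt b _ _ ⟨a⟩
  have hinj : ∀ b, Function.Injective fun j => cospanHeight b (e j) :=
    fun b => (cospanHeight_injective b).comp e.injective
  obtain ⟨φ, hφ, hφ'⟩ := DynkinPartition.exists_orderRules_of_height isAcyclic_cospan
    (fun j => cospanHeight true (e j)) (hinj true) (hlt true)
  obtain ⟨ψ, hψ, hψ'⟩ := DynkinPartition.exists_orderRules_of_height isAcyclic_cospan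
    (fun j => cospanHeight false (e j)) (hinj false) (hlt false)
  refine ⟨_, R, _, φ, ψ, DynkinPartition.isAdmissible_of_height _ (hlt true), ?_, hφ, hψ⟩
  rintro rfl
  let x : Bool → Cospan := fun b => (some b : Option Bool)
  have hx : ∀ b, (Pi.single (x b) 1 : Cospan → ℕ) ∈ (R.part (e.symm (x b))).posRoots := fun b =>
    Subquiver.single_mem_posRoots (e.apply_symm_apply (x b)).symm
  have hroot : ∀ b, (Pi.single (x b) 1 : Cospan → ℕ) ∈ R.roots :=
    fun b => Set.mem_iUnion.mpr ⟨_, hx b⟩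
  let a : Bool → Fin (Nat.card R.roots) := fun b => φ.symm ⟨_, hroot b⟩
  have ha : ∀ b, (φ (a b) : Cospan → ℕ) ∈ (R.part (e.symm (x b))).posRoots := by
    intro b
    simp only [a, Equiv.apply_symm_apply]
    exact hx b
  rcases lt_trichotomy (a true) (a false) with h | h | h
  · have h' : cospanHeight true (e (e.symm (x true))) ≤ cospanHeight true (e (e.symm (x false))) :=
      hφ' _ _ h _ _ (ha true) (ha false)
    rw [e.apply_symm_apply, e.apply_symm_apply] at h'
    simp [x, cospanHeight] at h'
  · have h1 := congrArg Subtype.val (φ.symm.injective h)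
    have h2 := congrFun h1 (x true)
    have h3 : x true ≠ x false := fun h => Bool.noConfusion (Option.some.inj h)
    simp [Pi.single_eq_of_ne h3] at h2
  · have h' : cospanHeight false (e (e.symm (x false))) ≤
        cospanHeight false (e (e.symm (x true))) :=
      hψ' _ _ h _ _ (ha false) (ha true)
    rw [e.apply_symm_apply, e.apply_symm_apply] at h'
    simp [x, cospanHeight] at h'

end QuiverRoots

theorem theorem2p2 {V : Type u} [Fintype V] [DecidableEq V] [Quiver.{v} V]
    [∀ i j : V, Finite (i ⟶ j)] (hQ : QuiverRoots.IsAcyclic V)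
    {ℓ : ℕ} (P : QuiverRoots.DynkinPartition V ℓ) :
    -- a total ordering satisfying the rules exists if and only if the partition is admissible
    ((∃ (r : ℕ) (φ : Fin r ≃ P.roots), P.OrderRules φ) ↔ P.IsAdmissible) ∧
    -- for an admissible partition the rules are equivalent to the simplified rules
    (P.IsAdmissible → ∀ (r : ℕ) (φ : Fin r ≃ P.roots), P.OrderRules φ ↔ P.SimpleOrderRules φ) ∧
    -- for an ordered partition, one can order each part by the first rule, and for every such
    -- choice the concatenation is an allowed total ordering
    (P.IsOrdered →
      (∃ (s : Fin ℓ → ℕ) (β : ∀ j, Fin (s j) ≃ (P.part j).posRoots), ∀ j, P.PartOrderRule j (β j)) ∧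
      ∀ (s : Fin ℓ → ℕ) (β : ∀ j, Fin (s j) ≃ (P.part j).posRoots),
        (∀ j, P.PartOrderRule j (β j)) →
          ∃ φ : Fin (∑ j, s j) ≃ P.roots, P.IsConcat β φ ∧ P.OrderRules φ ∧ P.SimpleOrderRules φ) ∧
    -- such a total ordering is in general not unique
    (∃ (W : Type) (_ : Fintype W) (_ : DecidableEq W) (_ : Quiver.{0} W)
        (_ : ∀ i j : W, Finite (i ⟶ j)) (m : ℕ) (R : QuiverRoots.DynkinPartition W m)
        (r : ℕ) (φ ψ : Fin r ≃ R.roots),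
      QuiverRoots.IsAcyclic W ∧ R.IsAdmissible ∧ φ ≠ ψ ∧ R.OrderRules φ ∧ R.OrderRules ψ) := by
  refine ⟨⟨?_, fun hP => ?_⟩, fun hP _ φ => hP.orderRules_iff φ, fun hP => ⟨?_, fun s β hβ => ?_⟩,
    ?_⟩
  · rintro ⟨r, φ, h⟩
    exact QuiverRoots.DynkinPartition.isAdmissible_of_orderRules hQ h
  · obtain ⟨f, hinj, hf⟩ := hP.exists_height
    obtain ⟨φ, hφ, -⟩ := QuiverRoots.DynkinPartition.exists_orderRules_of_height hQ f hinj hf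
    exact ⟨_, φ, hφ⟩
  · choose β hβ using hP.isAdmissible.exists_partOrderRule hQ
    exact ⟨_, β, hβ⟩
  · exact hP.exists_isConcat β hβ
  · obtain ⟨m, R, r, φ, ψ, hR, hne, hφ, hψ⟩ := QuiverRoots.exists_two_orderRules
    exact ⟨QuiverRoots.Cospan, inferInstance, inferInstance, inferInstance, inferInstance, m, R, r,
      φ, ψ, QuiverRoots.isAcyclic_cospan, hR, hne, hφ, hψ⟩
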